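/- **Conventions.** Let $(M,\mathcal F)$ be a Finsler manifold with Finsler function $\mathcal F\colon TM\to\mathbb R$ (continuous, smooth off the zero section, positive there, positively homogeneous of degree one, with $g_{ij}=\tfrac12\partial^2\mathcal F^2/\partial y^i\partial y^j$ positive definite for $y\neq0$). In local coordinates put $$G^i=\tfrac14 g^{il}\Big(2\tfrac{\partial g_{jl}}{\partial x^k}-\tfrac{\partial g_{jk}}{\partial x^l}\Big)y^jy^k,\quad G^i_j=\tfrac{\partial G^i}{\partial y^j},\quad G^i_{jk}=\tfrac{\partial G^i_j}{\partial y^k},$$ $$R^i_{jk}=\tfrac{\partial G^i_j}{\partial x^k}-\tfrac{\partial G^i_k}{\partial x^j}+G^m_jG^i_{km}-G^m_kG^i_{jm},\qquad R_{(x,y)}(X,Y)=R^i_{jk}(x,y)X^jY^k\tfrac{\partial}{\partial x^i}.$$ $(M,\mathcal F)$ has constant flag curvature $\lambda$ if $R^i_{jk}=\lambda(\delta^i_kg_{jm}y^m-\delta^i_jg_{km}y^m)$ for all $x$ and all $y\neq0$. The indicatrix at $x$ is $\mathcal I_xM=\{y\in T_xM:\mathcal F(x,y)=1\}$, and $\mathcal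 IM$ is the indicatrix bundle. The curvature algebra $\mathfrak R_x$ is the Lie algebra of vector fields on $\mathcal I_xM$ generated by the fields $y\mapsto R_{(x,y)}(X,Y)$, $X,Y\in T_xM$. The infinitesimal holonomy algebra $\mathfrak{hol}^*(M)$ is the smallest Lie algebra of vector fields on $\mathcal IM$ that contains the fields $r(X,Y)(x,y)=R_{(x,y)}(X_x,Y_x)$ for all smooth vector fields $X,Y$ on $M$ and is stable under the horizontal Berwald covariant derivative $$\nabla_X\xi=[X^h,\xi]=\Big(\tfrac{\partial\xi^i}{\partial x^j}-G^k_j\tfrac{\partial\xi^i}{\partial y^k}+G^i_{jk}\xi^k\Big)X^j\tfrac{\partial}{\partial y^i}$$ for all smooth vector fields $X$ on $M$; and $\mathfrak{hol}^*(x)$ is the set of restrictions to $\mathcal I_xM$ of its elements. **Shen's Randers surfaces.** For a Riemannian metric $h$, a vector field $v$ and a real number $\epsilon$ put $\mathcal F_\epsilon=\alpha+\beta$ with $$\alpha=\frac{\sqrt{\epsilon^2h(v,y)^2+h(y,y)\left(1-\epsilon^2h(v,v)\right)}}{1-\epsilon^2h(v,v)},\qquad \beta=\frac{\epsilon\,h(v,y)}{1-\epsilon^2h(v,v)}$$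 in the following two cases. (S) $M=S^2\subset\mathbb R^3$ is the unit sphere, $h$ its standard metric, $v=(-x_2,x_1,0)$ at $(x_1,x_2,x_3)$, and $|\epsilon|<1$. (D) $M=\{x\in\mathbb R^2:|x|<1/\sqrt{1+\epsilon^2}\}$ (the part of the unit disk where $\epsilon^2h(v,v)<1$), $h$ is the Klein metric $h(y,z)=\dfrac{\langle y,z\rangle(1-|x|^2)+\langle x,y\rangle\langle x,z\rangle}{(1-|x|^2)^2}$, $v=(-x_2,x_1)$ at $(x_1,x_2)$, and $\epsilon\in\mathbb R$ is arbitrary. **Theorem.** In case (S), $\mathcal F_\epsilon$ is a Finsler function on $S^2$ of constant flag curvature $1$. In case (D), $\mathcal F_\epsilon$ is a Finsler function on the disk of constant flag curvature $-1$. In both cases $\mathfrak{hol}^*(x)=\mathfrak R_x$ at every point $x\in M$. -/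

import Mathlib

open scoped Manifold ContDiff RealInnerProductSpace

/-- Euclidean coordinate space `ℝⁿ`. -/
abbrev Coord (n : ℕ) : Type := EuclideanSpace ℝ (Fin n)

noncomputable section

namespace Finsler

/-! ### Local formulas

Here `L : ℝⁿ → ℝⁿ → ℝ` is the expression `L u y` of a Finsler function in a local chart: `u` are
the coordinates of the point and `y` the induced fibre coordinates. -/

section LocalFormulas

variable {n : ℕ}

/-- `∂f/∂xʲ (u, y)`. -/
def dX (j : Fin n) (f : Coord n → Coord n → ℝ) (u y : Coord n) : ℝ :=
  fderiv ℝ (fun z => f z y) u (EuclideanSpace.single j 1)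

/-- `∂f/∂yʲ (u, y)`. -/
def dY (j : Fin n) (f : Coord n → Coord n → ℝ) (u y : Coord n) : ℝ :=
  fderiv ℝ (fun z => f u z) y (EuclideanSpace.single j 1)

/-- `g_{ij} = ½ ∂²L²/∂yⁱ∂yʲ`. -/
def fundTensor (L : Coord n → Coord n → ℝ) (i j : Fin n) (u y : Coord n) : ℝ :=
  (1 / 2) * dY i (dY j (fun u y => L u y ^ 2)) u y

/-- `g^{il}`, the inverse matrix of `g_{ij}`. -/
def fundTensorInv (L : Coord n → Coord n → ℝ) (i l : Fin n) (u y : Coord n) : ℝ :=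
  (Matrix.of fun a b => fundTensor L a b u y)⁻¹ i l

/-- The geodesic coefficients
`Gⁱ = ¼ g^{il} (2 ∂g_{jl}/∂xᵏ - ∂g_{jk}/∂xˡ) yʲ yᵏ`. -/
def geodCoeff (L : Coord n → Coord n → ℝ) (i : Fin n) (u y : Coord n) : ℝ :=
  (1 / 4) * ∑ l, fundTensorInv L i l u y *
    ∑ j, ∑ k, (2 * dX k (fundTensor L j l) u y - dX l (fundTensor L j k) u y) * y j * y k

/-- `Gⁱ_j = ∂Gⁱ/∂yʲ`. -/
def connCoeff (L : Coord n → Coord n → ℝ) (i j : Fin n) : Coord n → Coord n → ℝ :=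
  dY j (geodCoeff L i)

/-- `Gⁱ_{jk} = ∂Gⁱ_j/∂yᵏ`. -/
def berwaldCoeff (L : Coord n → Coord n → ℝ) (i j k : Fin n) : Coord n → Coord n → ℝ :=
  dY k (connCoeff L i j)

/-- The components
`Rⁱ_{jk} = ∂Gⁱ_j/∂xᵏ - ∂Gⁱ_k/∂xʲ + Gᵐ_j Gⁱ_{km} - Gᵐ_k Gⁱ_{jm}` of the curvature
`R(X, Y) = v[Xʰ, Yʰ]` of the horizontal distribution. -/
def curvCoeff (L : Coord n → Coord n → ℝ) (i j k : Fin n) (u y : Coord n) : ℝ :=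
  dX k (connCoeff L i j) u y - dX j (connCoeff L i k) u y
    + ∑ m, (connCoeff L m j u y * berwaldCoeff L i k m u y
      - connCoeff L m k u y * berwaldCoeff L i j m u y)

/-- The horizontal Berwald covariant derivative `∇_X ξ = [Xʰ, ξ]` of the vertical field
`ξ = ξⁱ ∂/∂yⁱ` in coordinates:
`(∂ξⁱ/∂xʲ - G_jᵏ ∂ξⁱ/∂yᵏ + Gⁱ_{jk} ξᵏ) Xʲ ∂/∂yⁱ`. -/
def berwaldDeriv (L : Coord n → Coord n → ℝ) (X : Coord n) (ξ : Coord n → Coord n → Coord n)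
    (u y : Coord n) : Coord n :=
  WithLp.toLp 2 fun i => ∑ j, (dX j (fun u y => ξ u y i) u y
    - ∑ k, connCoeff L k j u y * dY k (fun u y => ξ u y i) u y
    + ∑ k, berwaldCoeff L i j k u y * ξ u y k) * X j

end LocalFormulas

/-! ### Finsler functions on manifolds -/

section Manifolds

variable {n : ℕ} {M : Type*} [TopologicalSpace M] [ChartedSpace (Coord n) M]

/-- In Mathlib the tangent space at `x` is `ℝⁿ`, a tangent vector being given by its components
in the chart `chartAt x`.  This map reads off these components. -/
def toCoord (x : M) (w : TangentSpace (𝓡 n) x) : Coord n := w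

/-- The tangent vector at `x` with given components in the chart `chartAt x`. -/
def ofCoord (x : M) (w : Coord n) : TangentSpace (𝓡 n) x := w

/-- The expression of `F : TM → ℝ` in the chart `φ` around `x₀`:
`(u, y) ↦ F (φ⁻¹ u, d(φ⁻¹)_u y)`. -/
def inChart (F : ∀ x : M, TangentSpace (𝓡 n) x → ℝ) (x₀ : M) (u y : Coord n) : ℝ :=
  F ((chartAt (Coord n) x₀).symm u)
    (mfderiv (𝓡 n) (𝓡 n) (chartAt (Coord n) x₀).symm u (ofCoord u y))

/-- `F` is a Finsler function on `M`: continuous on `TM`, smooth off the zero section, positive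
and positively homogeneous of degree one, with positive definite `g_{ij}(x, y)` for `y ≠ 0`. -/
structure IsFinsler [IsManifold (𝓡 n) 1 M] (F : ∀ x : M, TangentSpace (𝓡 n) x → ℝ) : Prop where
  continuous : Continuous fun p : TangentBundle (𝓡 n) M => F p.1 p.2
  smooth : ContMDiffOn (𝓡 n).tangent 𝓘(ℝ, ℝ) ∞ (fun p : TangentBundle (𝓡 n) M => F p.1 p.2)
    {p | p.2 ≠ 0}
  pos : ∀ (x : M) (y : TangentSpace (𝓡 n) x), y ≠ 0 → 0 < F x y
  homogeneous : ∀ (x : M) (y : TangentSpace (𝓡 n) x) (t : ℝ), 0 ≤ t → F x (t • y) = t * F x y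
  posDef : ∀ (x : M) (y w : TangentSpace (𝓡 n) x), y ≠ 0 → w ≠ 0 →
    0 < ∑ i, ∑ j, fundTensor (inChart F x) i j (chartAt (Coord n) x x) (toCoord x y)
      * toCoord x w i * toCoord x w j

/-- `(M, F)` has constant flag curvature `lam`:
`Rⁱ_{jk} = lam (δⁱ_k g_{jm} yᵐ - δⁱ_j g_{km} yᵐ)` at every `(x, y)` with `y ≠ 0`. -/
def HasConstantFlagCurvature (F : ∀ x : M, TangentSpace (𝓡 n) x → ℝ) (lam : ℝ) : Prop :=
  ∀ (x : M) (y : TangentSpace (𝓡 n) x), y ≠ 0 → ∀ i j k : Fin n,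
    curvCoeff (inChart F x) i j k (chartAt (Coord n) x x) (toCoord x y) =
      lam * ((if i = k then 1 else 0) *
          ∑ m, fundTensor (inChart F x) j m (chartAt (Coord n) x x) (toCoord x y) * toCoord x y m
        - (if i = j then 1 else 0) *
          ∑ m, fundTensor (inChart F x) k m (chartAt (Coord n) x x) (toCoord x y) * toCoord x y m)

/-- The indicatrix `I_x = {y ∈ T_xM | F (x, y) = 1}`. -/
abbrev Indicatrix (F : ∀ x : M, TangentSpace (𝓡 n) x → ℝ) (x : M) : Type :=
  {y : TangentSpace (𝓡 n) x // F x y = 1}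

/-- Fields of vectors along the indicatrix `I_x`. -/
abbrev FieldAt (F : ∀ x : M, TangentSpace (𝓡 n) x → ℝ) (x : M) : Type :=
  Indicatrix F x → TangentSpace (𝓡 n) x

/-- Vertical fields along the indicatrix bundle. -/
abbrev BundleField (F : ∀ x : M, TangentSpace (𝓡 n) x → ℝ) : Type _ :=
  ∀ x : M, FieldAt F x

variable (F : ∀ x : M, TangentSpace (𝓡 n) x → ℝ)

open Classical in
/-- The extension of a field `ξ` along `I_x` to `T_xM ∖ {0}` that is positively homogeneous of
degree one, `y ↦ F(y) ξ(y / F(y))`.  Derivatives of `ξ` along directions tangent to the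
indicatrix are computed with it; brackets of fields tangent to the indicatrix (bundle) do not
depend on the extension. -/
def homExt (x : M) (ξ : FieldAt F x) (y : TangentSpace (𝓡 n) x) : TangentSpace (𝓡 n) x :=
  if h : F x ((F x y)⁻¹ • y) = 1 then F x y • ξ ⟨(F x y)⁻¹ • y, h⟩ else 0

/-- The Lie bracket of vector fields on the indicatrix `I_x`. -/
def fibreBracket (x : M) (ξ η : FieldAt F x) : FieldAt F x := fun y =>
  ofCoord x (VectorField.lieBracket ℝ
    (fun z => toCoord x (homExt F x ξ (ofCoord x z)))
    (fun z => toCoord x (homExt F x η (ofCoord x z))) (toCoord x y.1))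

/-- The Lie bracket of vertical vector fields on the indicatrix bundle. -/
def bracket (ξ η : BundleField F) : BundleField F := fun x => fibreBracket F x (ξ x) (η x)

/-- The expression in the chart `φ` around `x₀` of (the homogeneous extension of) a vertical
field: `(u, y) ↦ dφ (ξ (φ⁻¹ u, d(φ⁻¹)_u y))`. -/
def fieldInChart (ξ : BundleField F) (x₀ : M) (u y : Coord n) : Coord n :=
  toCoord u (mfderiv (𝓡 n) (𝓡 n) (chartAt (Coord n) x₀) ((chartAt (Coord n) x₀).symm u)
    (homExt F ((chartAt (Coord n) x₀).symm u) (ξ ((chartAt (Coord n) x₀).symm u))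
      (mfderiv (𝓡 n) (𝓡 n) (chartAt (Coord n) x₀).symm u (ofCoord u y))))

/-- The horizontal Berwald covariant derivative `∇_X ξ = [Xʰ, ξ]` on the indicatrix bundle. -/
def nabla (X : ∀ x : M, TangentSpace (𝓡 n) x) (ξ : BundleField F) : BundleField F := fun x y =>
  ofCoord x (berwaldDeriv (inChart F x) (toCoord x (X x)) (fieldInChart F ξ x)
    (chartAt (Coord n) x x) (toCoord x y.1))

/-- For tangent vectors `X, Y` at `x`, the curvature vector field `y ↦ R_{(x,y)}(X, Y)` on the
indicatrix at `x`. -/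
def curvFieldAt (x : M) (X Y : TangentSpace (𝓡 n) x) : FieldAt F x := fun y =>
  ofCoord x (WithLp.toLp 2 fun i => ∑ j, ∑ k,
    curvCoeff (inChart F x) i j k (chartAt (Coord n) x x) (toCoord x y.1)
      * toCoord x X j * toCoord x Y k)

/-- The curvature vector field `r(X, Y)` of two vector fields `X, Y` on `M`. -/
def curvField (X Y : ∀ x : M, TangentSpace (𝓡 n) x) : BundleField F := fun x =>
  curvFieldAt F x (X x) (Y x)

/-- `X` is a smooth vector field on `M`. -/
def IsSmoothField [IsManifold (𝓡 n) 1 M] (X : ∀ x : M, TangentSpace (𝓡 n) x) : Prop :=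
  ContMDiff (𝓡 n) (𝓡 n).tangent ∞ (fun x => (⟨x, X x⟩ : TangentBundle (𝓡 n) M))

/-- The curvature algebra `R_x` at `x`: the Lie algebra of vector fields on the indicatrix at `x`
generated by the curvature vector fields at `x`. -/
def curvatureAlgebraAt (x : M) : Submodule ℝ (FieldAt F x) :=
  sInf {S | (∀ X Y : TangentSpace (𝓡 n) x, curvFieldAt F x X Y ∈ S) ∧
    ∀ ξ ∈ S, ∀ η ∈ S, fibreBracket F x ξ η ∈ S}

/-- The infinitesimal holonomy algebra `hol*(M)`: the smallest Lie algebra of vector fields on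
the indicatrix bundle that contains the curvature vector fields and is stable under `∇_X` for
all smooth vector fields `X` on `M`. -/
def holonomyAlgebra [IsManifold (𝓡 n) 1 M] : Submodule ℝ (BundleField F) :=
  sInf {S | (∀ X Y : ∀ x : M, TangentSpace (𝓡 n) x, IsSmoothField X → IsSmoothField Y →
      curvField F X Y ∈ S) ∧
    (∀ ξ ∈ S, ∀ η ∈ S, bracket F ξ η ∈ S) ∧
    ∀ ξ ∈ S, ∀ X : ∀ x : M, TangentSpace (𝓡 n) x, IsSmoothField X → nabla F X ξ ∈ S}

/-- The infinitesimal holonomy algebra `hol*(x)` at `x`: the restrictions to the indicatrix at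
`x` of the elements of `hol*(M)`. -/
def holonomyAlgebraAt [IsManifold (𝓡 n) 1 M] (x : M) : Submodule ℝ (FieldAt F x) :=
  (holonomyAlgebra F).map (LinearMap.proj x)

/-- The Randers function `α + β` with
`α = √(ε² h(v,y)² + h(y,y) (1 - ε² h(v,v))) / (1 - ε² h(v,v))` and
`β = ε h(v,y) / (1 - ε² h(v,v))`, for a Riemannian metric `h` and a vector field `v`. -/
def shenRanders (h : ∀ x : M, TangentSpace (𝓡 n) x → TangentSpace (𝓡 n) x → ℝ)
    (v : ∀ x : M, TangentSpace (𝓡 n) x) (ε : ℝ) (x : M) (y : TangentSpace (𝓡 n) x) : ℝ :=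
  √(ε ^ 2 * h x (v x) y ^ 2 + h x y y * (1 - ε ^ 2 * h x (v x) (v x)))
      / (1 - ε ^ 2 * h x (v x) (v x))
    + ε * h x (v x) y / (1 - ε ^ 2 * h x (v x) (v x))

end Manifolds

/-! ### The surfaces on the sphere -/

/-- The unit sphere `S² ⊂ ℝ³`. -/
abbrev Sphere2 : Type := Metric.sphere (0 : EuclideanSpace ℝ (Fin (2 + 1))) 1

/-- The vector of `ℝ³` corresponding to a tangent vector of `S²`. -/
def sphereIncl (x : Sphere2) : TangentSpace (𝓡 2) x →L[ℝ] EuclideanSpace ℝ (Fin (2 + 1)) :=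
  mvfderiv (𝓡 2) ((↑) : Sphere2 → EuclideanSpace ℝ (Fin (2 + 1))) x

/-- The standard metric of `S²`. -/
def sphereMetric (x : Sphere2) (y z : TangentSpace (𝓡 2) x) : ℝ :=
  ⟪sphereIncl x y, sphereIncl x z⟫

theorem exists_sphereField (x : Sphere2) :
    ∃ w : TangentSpace (𝓡 2) x, sphereIncl x w = !₂[-x.1 1, x.1 0, 0] := by
  have : Fact (Module.finrank ℝ (EuclideanSpace ℝ (Fin (2 + 1))) = 2 + 1) := ⟨by simp⟩
  have h : (!₂[-x.1 1, x.1 0, 0] : EuclideanSpace ℝ (Fin (2 + 1))) ∈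
      (mvfderiv (𝓡 2) ((↑) : Sphere2 → EuclideanSpace ℝ (Fin (2 + 1))) x).range := by
    rw [range_mvfderiv_subtypeVal, Submodule.mem_orthogonal_singleton_iff_inner_right]
    simp [PiLp.inner_apply, Fin.sum_univ_three]
    ring
  exact h

/-- The vector field `v = (-x₂, x₁, 0)` at `(x₁, x₂, x₃) ∈ S²`. -/
def sphereField (x : Sphere2) : TangentSpace (𝓡 2) x := (exists_sphereField x).choose

theorem sphereIncl_sphereField (x : Sphere2) :
    sphereIncl x (sphereField x) = !₂[-x.1 1, x.1 0, 0] :=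
  (exists_sphereField x).choose_spec

/-- The Randers function with parameter `ε` on `S²`. -/
def sphereRanders (ε : ℝ) : ∀ x : Sphere2, TangentSpace (𝓡 2) x → ℝ :=
  shenRanders sphereMetric sphereField ε

/-! ### The surfaces on the disk -/

/-- The open disk about the origin of radius `(1 + ε²)^(-1/2)`: the part of the unit disk where
`ε² h(v,v) < 1`. -/
def disk (ε : ℝ) : TopologicalSpace.Opens (EuclideanSpace ℝ (Fin 2)) :=
  ⟨Metric.ball 0 (1 / √(1 + ε ^ 2)), Metric.isOpen_ball⟩

/-- The Klein metric of the unit disk. -/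
def kleinMetric (x y z : EuclideanSpace ℝ (Fin 2)) : ℝ :=
  (⟪y, z⟫ * (1 - ‖x‖ ^ 2) + ⟪x, y⟫ * ⟪x, z⟫) / (1 - ‖x‖ ^ 2) ^ 2

/-- The Klein metric on the smaller disk; the charts of an open subset of `ℝ²` are the inclusion,
so that tangent vectors are vectors of `ℝ²`. -/
def diskMetric (ε : ℝ) (x : disk ε) (y z : TangentSpace (𝓡 2) x) : ℝ :=
  kleinMetric x.1 (toCoord x y) (toCoord x z)

/-- The vector field `v = (-x₂, x₁)` at `(x₁, x₂)`. -/
def diskField (ε : ℝ) (x : disk ε) : TangentSpace (𝓡 2) x := ofCoord x !₂[-x.1 1, x.1 0]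

/-- The Randers function with parameter `ε` on the disk. -/
def diskRanders (ε : ℝ) : ∀ x : disk ε, TangentSpace (𝓡 2) x → ℝ :=
  shenRanders (diskMetric ε) (diskField ε) ε

end Finsler

end

/-! The function `α + β` solves a navigation problem: with W = -εv, F is the positive root of h(y -
FW, y - FW) = F². In both cases W is a Killing field on a surface of constant curvature K = ±1, so
∇W = aJ, where J is the parallel rotation by a right angle, and Xa = -K h(JX, W).

Put N = y - FW and μ = F + h(N, W). Then h(N, N) = F², and the fibre derivative of F is p(e) = h(N,
e)/μ. Implicit differentiation gives closed formulas for the metric tensor, the geodesic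
coefficients and the connection (`gt_eq`, `gt_geodesic`, `hasDirDeriv_G`). Since p(JN) = 0, F is
constant along horizontal directions. The curvature becomes R(X, Y) = K F (p(X) Y - p(Y) X)
(`curvature_eq`), which is constant flag curvature K. In dimension two the right side equals K h(JX,
Y) ξ, with the single vertical field ξ = (F/μ) JN (`p_smul_sub`), called `vert` below.

The decisive fact is that ξ is parallel for the Berwald derivative (`dvert_add_dconn`). Hence
∇_X(fξ) = (Xf) ξ for functions f on M. The fields fξ with smooth f contain all curvature fields,
commute with each other on every fibre, and are stable under ∇ (`holonomyAlgebra_le`). At a point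
they restrict to multiples of ξ, and because K ≠ 0 the curvature fields there already give all of
these multiples (`holonomyAlgebraAt_eq`).

The sphere is treated in stereographic coordinates and the disk in Klein coordinates; what remains
is to verify the axioms of `KillingData` there. -/

noncomputable section
namespace Finsler

/-! ### Directional derivatives -/

section DirDeriv

variable {E V V' : Type*} [NormedAddCommGroup E] [NormedSpace ℝ E]
  [NormedAddCommGroup V] [NormedSpace ℝ V] [NormedAddCommGroup V'] [NormedSpace ℝ V']

/-- `f` is differentiable at `q` and `d v` is its derivative in the direction `v`. -/
def HasDirDeriv (f : E → V) (q : E) (d : E → V) : Prop :=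
  ∃ D : E →L[ℝ] V, HasFDerivAt f D q ∧ ∀ v, D v = d v

namespace HasDirDeriv

variable {f g : E → V} {q : E} {d e : E → V} {s : E → ℝ} {ds : E → ℝ}

theorem congr_deriv (h : HasDirDeriv f q d) (hde : ∀ v, d v = e v) : HasDirDeriv f q e := by
  obtain ⟨D, hD, hd⟩ := h
  exact ⟨D, hD, fun v => (hd v).trans (hde v)⟩

theorem congr_of_eventuallyEq (h : HasDirDeriv f q d) (hg : g =ᶠ[nhds q] f) :
    HasDirDeriv g q d := by
  obtain ⟨D, hD, hd⟩ := h
  exact ⟨D, hD.congr_of_eventuallyEq hg, hd⟩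

theorem fderiv_apply (h : HasDirDeriv f q d) (v : E) : fderiv ℝ f q v = d v := by
  obtain ⟨D, hD, hd⟩ := h
  rw [hD.fderiv, hd]

theorem differentiableAt (h : HasDirDeriv f q d) : DifferentiableAt ℝ f q := by
  obtain ⟨D, hD, hd⟩ := h
  exact hD.differentiableAt

theorem _root_.DifferentiableAt.hasDirDeriv (h : DifferentiableAt ℝ f q) :
    HasDirDeriv f q (fun v => fderiv ℝ f q v) :=
  ⟨_, h.hasFDerivAt, fun _ => rfl⟩

theorem unique (h : HasDirDeriv f q d) (h' : HasDirDeriv f q e) (v : E) : d v = e v := by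
  rw [← h.fderiv_apply, h'.fderiv_apply]

theorem const (c : V) : HasDirDeriv (fun _ : E => c) q (fun _ => 0) :=
  ⟨0, hasFDerivAt_const c q, fun _ => rfl⟩

theorem clm (A : E →L[ℝ] V) : HasDirDeriv (fun z => A z) q (fun v => A v) :=
  ⟨A, A.hasFDerivAt, fun _ => rfl⟩

theorem id : HasDirDeriv (fun z : E => z) q (fun v => v) :=
  clm (ContinuousLinearMap.id ℝ E)

theorem add (hf : HasDirDeriv f q d) (hg : HasDirDeriv g q e) :
    HasDirDeriv (fun z => f z + g z) q (fun v => d v + e v) := by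
  obtain ⟨D, hD, hd⟩ := hf
  obtain ⟨D', hD', hd'⟩ := hg
  exact ⟨D + D', hD.add hD', fun v => by simp [hd, hd']⟩

theorem sub (hf : HasDirDeriv f q d) (hg : HasDirDeriv g q e) :
    HasDirDeriv (fun z => f z - g z) q (fun v => d v - e v) := by
  obtain ⟨D, hD, hd⟩ := hf
  obtain ⟨D', hD', hd'⟩ := hg
  exact ⟨D - D', hD.sub hD', fun v => by simp [hd, hd']⟩

theorem smul (hs : HasDirDeriv s q ds) (hg : HasDirDeriv g q e) :
    HasDirDeriv (fun z => s z • g z) q (fun v => ds v • g q + s q • e v) := by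
  obtain ⟨D, hD, hd⟩ := hs
  obtain ⟨D', hD', hd'⟩ := hg
  refine ⟨_, hD.smul hD', fun v => ?_⟩
  simp [hd, hd', add_comm]

theorem mul {t dt : E → ℝ} (hs : HasDirDeriv s q ds) (ht : HasDirDeriv t q dt) :
    HasDirDeriv (fun z => s z * t z) q (fun v => ds v * t q + s q * dt v) :=
  hs.smul ht

theorem inv (hs : HasDirDeriv s q ds) (h0 : s q ≠ 0) :
    HasDirDeriv (fun z => (s z)⁻¹) q (fun v => - ds v / s q ^ 2) := by
  obtain ⟨D, hD, hd⟩ := hs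
  refine ⟨_, (hasDerivAt_inv h0).comp_hasFDerivAt q hD, fun v => ?_⟩
  simp [hd]
  ring

theorem div {t dt : E → ℝ} (hs : HasDirDeriv s q ds) (ht : HasDirDeriv t q dt) (h0 : t q ≠ 0) :
    HasDirDeriv (fun z => s z / t z) q (fun v => ds v / t q - s q * dt v / t q ^ 2) := by
  simp only [div_eq_mul_inv]
  refine (hs.mul (ht.inv h0)).congr_deriv fun v => ?_
  field_simp
  ring

theorem clm_apply {A dA : E → V →L[ℝ] V'} (hA : HasDirDeriv A q dA) (hg : HasDirDeriv g q e) :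
    HasDirDeriv (fun z => A z (g z)) q (fun v => dA v (g q) + A q (e v)) := by
  obtain ⟨D, hD, hd⟩ := hA
  obtain ⟨D', hD', hd'⟩ := hg
  refine ⟨_, hD.clm_apply hD', fun v => ?_⟩
  simp [hd, hd', add_comm]

theorem comp {E' : Type*} [NormedAddCommGroup E'] [NormedSpace ℝ E'] {k : E' → E} {q' : E'}
    {dk : E' → E} (hf : HasDirDeriv f (k q') d) (hk : HasDirDeriv k q' dk) :
    HasDirDeriv (fun z => f (k z)) q' (fun v => d (dk v)) := by
  obtain ⟨D, hD, hd⟩ := hf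
  obtain ⟨D', hD', hd'⟩ := hk
  exact ⟨_, hD.comp q' hD', fun v => by simp [hd, hd']⟩

theorem comp_fst {E' : Type*} [NormedAddCommGroup E'] [NormedSpace ℝ E'] {r : E × E'}
    (hf : HasDirDeriv f r.1 d) : HasDirDeriv (fun z : E × E' => f z.1) r (fun v => d v.1) :=
  hf.comp (k := Prod.fst) (clm (ContinuousLinearMap.fst ℝ E E'))

theorem snd {E' : Type*} [NormedAddCommGroup E'] [NormedSpace ℝ E'] {r : E × E'} :
    HasDirDeriv (fun z : E × E' => z.2) r (fun v => v.2) :=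
  clm (ContinuousLinearMap.snd ℝ E E')

theorem comp_clm (A : V →L[ℝ] V') (hf : HasDirDeriv f q d) :
    HasDirDeriv (fun z => A (f z)) q (fun v => A (d v)) :=
  HasDirDeriv.comp (f := fun w => A w) (clm A) hf

end HasDirDeriv

end DirDeriv

section Partial

variable {n : ℕ}

/-- Agreement on an open set is enough because differentiation is local. Each coefficient can thus
be replaced by its closed form on y ≠ 0 before it is differentiated again. -/
theorem dX_eq_of_hasDirDeriv {O : Set (Coord n × Coord n)} (hO : IsOpen O)
    {f : Coord n → Coord n → ℝ} {g : Coord n × Coord n → ℝ} {d : Coord n × Coord n → ℝ}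
    (hfg : ∀ q ∈ O, f q.1 q.2 = g q) {q : Coord n × Coord n} (hq : q ∈ O)
    (hg : HasDirDeriv g q d) (j : Fin n) : dX j f q.1 q.2 = d (EuclideanSpace.single j 1, 0) := by
  have h1 : HasDirDeriv (fun p : Coord n × Coord n => f p.1 p.2) q d :=
    hg.congr_of_eventuallyEq (Filter.eventuallyEq_of_mem (hO.mem_nhds hq) hfg)
  have h2 : HasDirDeriv (fun z : Coord n => (z, q.2)) q.1 (fun v => (v, 0)) :=
    ⟨_, (hasFDerivAt_id q.1).prodMk (hasFDerivAt_const q.2 q.1), fun v => rfl⟩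
  exact (HasDirDeriv.comp (k := fun z : Coord n => (z, q.2)) (q' := q.1) h1 h2).fderiv_apply _

theorem dY_eq_of_hasDirDeriv {O : Set (Coord n × Coord n)} (hO : IsOpen O)
    {f : Coord n → Coord n → ℝ} {g : Coord n × Coord n → ℝ} {d : Coord n × Coord n → ℝ}
    (hfg : ∀ q ∈ O, f q.1 q.2 = g q) {q : Coord n × Coord n} (hq : q ∈ O)
    (hg : HasDirDeriv g q d) (j : Fin n) : dY j f q.1 q.2 = d (0, EuclideanSpace.single j 1) := by
  have h1 : HasDirDeriv (fun p : Coord n × Coord n => f p.1 p.2) q d :=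
    hg.congr_of_eventuallyEq (Filter.eventuallyEq_of_mem (hO.mem_nhds hq) hfg)
  have h2 : HasDirDeriv (fun z : Coord n => (q.1, z)) q.2 (fun v => (0, v)) :=
    ⟨_, (hasFDerivAt_const q.1 q.2).prodMk (hasFDerivAt_id q.2), fun v => rfl⟩
  exact (HasDirDeriv.comp (k := fun z : Coord n => (q.1, z)) (q' := q.2) h1 h2).fderiv_apply _

theorem HasDirDeriv.coord {E : Type*} [NormedAddCommGroup E] [NormedSpace ℝ E] {f d : E → Coord n}
    {q : E} (h : HasDirDeriv f q d) (i : Fin n) :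
    HasDirDeriv (fun z => f z i) q (fun v => d v i) :=
  h.comp_clm (EuclideanSpace.proj i)

end Partial

end Finsler
end

noncomputable section
namespace Finsler

/-! ### Randers functions with Killing navigation data, in a chart -/

/-- In an open set `U` of `ℝⁿ`: a Riemannian metric `h` with Christoffel symbols `Γ`, a parallel
rotation `J` by a right angle, and a vector field `W` with `h(W, W) < 1` and `∇W = a J`.  The metric
has curvature `K`, and the dimension two is expressed by `wedge`. -/
structure KillingData (n : ℕ) (K : ℝ) where
  U : Set (Coord n)
  isOpen_U : IsOpen U
  h : Coord n → Coord n →L[ℝ] Coord n →L[ℝ] ℝ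
  Γ : Coord n → Coord n →L[ℝ] Coord n →L[ℝ] Coord n
  J : Coord n → Coord n →L[ℝ] Coord n
  W : Coord n → Coord n
  a : Coord n → ℝ
  h_symm : ∀ u X Y, h u X Y = h u Y X
  h_pos : ∀ u ∈ U, ∀ X, X ≠ 0 → 0 < h u X X
  Γ_symm : ∀ u X Y, Γ u X Y = Γ u Y X
  W_lt : ∀ u ∈ U, h u (W u) (W u) < 1
  J_skew : ∀ u ∈ U, ∀ X Y, h u (J u X) Y = - h u X (J u Y)
  J_sq : ∀ u ∈ U, ∀ X, J u (J u X) = -X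
  wedge : ∀ u ∈ U, ∀ X Y Z, h u X Y • Z - h u X Z • Y = h u (J u Y) Z • J u X
  deriv_h : ∀ u ∈ U, ∃ D, HasDirDeriv h u D ∧
    ∀ X Y Z, D X Y Z = h u (Γ u X Y) Z + h u Y (Γ u X Z)
  deriv_W : ∀ u ∈ U, HasDirDeriv W u (fun X => a u • J u X - Γ u X (W u))
  deriv_J : ∀ u ∈ U, ∃ D, HasDirDeriv J u D ∧
    ∀ X Y, D X Y = J u (Γ u X Y) - Γ u X (J u Y)
  -- The second covariant derivative of a Killing field is determined by the curvature; on a surface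
  -- with ∇W = aJ this reads Xa = -K h(JX, W).
  deriv_a : ∀ u ∈ U, HasDirDeriv a u (fun X => -(K * h u (J u X) (W u)))
  deriv_Γ : ∀ u ∈ U, ∃ D, HasDirDeriv Γ u D ∧ ∀ X Y Z,
    D X Y Z - D Y X Z + Γ u X (Γ u Y Z) - Γ u Y (Γ u X Z) = K • (h u Y Z • X - h u X Z • Y)

namespace KillingData

variable {n : ℕ} {K : ℝ} (d : KillingData n K)

/-- The domain `y ≠ 0`. -/
def dom : Set (Coord n × Coord n) := {q | q.1 ∈ d.U ∧ q.2 ≠ 0}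

theorem isOpen_dom : IsOpen d.dom :=
  (d.isOpen_U.preimage continuous_fst).inter (isOpen_ne.preimage continuous_snd)

/-- `1 - h(W, W)`. -/
def κ (u : Coord n) : ℝ := 1 - d.h u (d.W u) (d.W u)

/-- The square root in the Randers function. -/
def μ (q : Coord n × Coord n) : ℝ :=
  √(d.h q.1 (d.W q.1) q.2 ^ 2 + d.h q.1 q.2 q.2 * d.κ q.1)

/-- The Randers function with navigation data `h`, `W`. -/
def F (q : Coord n × Coord n) : ℝ := (d.μ q - d.h q.1 (d.W q.1) q.2) / d.κ q.1

/-- `y - F W`. -/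
def N (q : Coord n × Coord n) : Coord n := q.2 - d.F q • d.W q.1

/-- The derivative of `F` in `y`. -/
def p (q : Coord n × Coord n) (e : Coord n) : ℝ := d.h q.1 (d.N q) e / d.μ q

theorem κ_pos {u : Coord n} (hu : u ∈ d.U) : 0 < d.κ u := by
  have := d.W_lt u hu
  unfold κ
  linarith

theorem radicand_pos {q : Coord n × Coord n} (hq : q ∈ d.dom) :
    0 < d.h q.1 (d.W q.1) q.2 ^ 2 + d.h q.1 q.2 q.2 * d.κ q.1 := by
  have h1 := d.h_pos q.1 hq.1 q.2 hq.2
  have h2 := d.κ_pos hq.1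
  positivity

theorem μ_pos {q : Coord n × Coord n} (hq : q ∈ d.dom) : 0 < d.μ q :=
  Real.sqrt_pos.2 (d.radicand_pos hq)

theorem μ_sq {q : Coord n × Coord n} (hq : q ∈ d.dom) :
    d.μ q ^ 2 = d.h q.1 (d.W q.1) q.2 ^ 2 + d.h q.1 q.2 q.2 * d.κ q.1 :=
  Real.sq_sqrt (d.radicand_pos hq).le

theorem μ_eq {q : Coord n × Coord n} (hq : q ∈ d.dom) :
    d.μ q = d.κ q.1 * d.F q + d.h q.1 (d.W q.1) q.2 := by
  have h2 := (d.κ_pos hq.1).ne'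
  unfold F
  field_simp
  ring

theorem F_pos {q : Coord n × Coord n} (hq : q ∈ d.dom) : 0 < d.F q := by
  have h2 := d.κ_pos hq.1
  refine div_pos (sub_pos.2 (lt_of_le_of_lt (le_abs_self _) ?_)) h2
  refine Real.lt_sqrt_of_sq_lt ?_
  rw [sq_abs]
  have := mul_pos (d.h_pos q.1 hq.1 q.2 hq.2) h2
  linarith

/-- The navigation equation h(y - FW, y - FW) = F² in a form without square roots, suited to
implicit differentiation. -/
theorem F_quadratic {q : Coord n × Coord n} (hq : q ∈ d.dom) :
    d.κ q.1 * d.F q ^ 2 + 2 * d.F q * d.h q.1 (d.W q.1) q.2 = d.h q.1 q.2 q.2 := by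
  have h1 := d.μ_sq hq
  rw [d.μ_eq hq] at h1
  have h2 := (d.κ_pos hq.1).ne'
  apply mul_left_cancel₀ h2
  linear_combination h1

theorem μ_eq_F_add {q : Coord n × Coord n} (hq : q ∈ d.dom) :
    d.μ q = d.F q + d.h q.1 (d.N q) (d.W q.1) := by
  rw [d.μ_eq hq]
  simp only [N, κ, map_sub, map_smul, sub_apply, smul_apply,
    smul_eq_mul, d.h_symm q.1 q.2]
  ring

theorem h_N_N {q : Coord n × Coord n} (hq : q ∈ d.dom) :
    d.h q.1 (d.N q) (d.N q) = d.F q ^ 2 := by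
  have h1 := d.F_quadratic hq
  simp only [κ] at h1
  simp only [N, map_sub, map_smul, sub_apply, smul_apply,
    smul_eq_mul, d.h_symm q.1 q.2 (d.W q.1)]
  linear_combination -h1

theorem h_J_self {u : Coord n} (hu : u ∈ d.U) (X : Coord n) : d.h u X (d.J u X) = 0 := by
  have := d.J_skew u hu X X
  rw [d.h_symm] at this
  linarith

theorem p_JN {q : Coord n × Coord n} (hq : q ∈ d.dom) : d.p q (d.J q.1 (d.N q)) = 0 := by
  rw [p, d.h_J_self hq.1, zero_div]

theorem μ_mul_p {q : Coord n × Coord n} (hq : q ∈ d.dom) (e : Coord n) :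
    d.μ q * d.p q e = d.h q.1 (d.N q) e := by
  have := (d.μ_pos hq).ne'
  unfold p
  field_simp

theorem p_sub (q : Coord n × Coord n) (X Y : Coord n) : d.p q (X - Y) = d.p q X - d.p q Y := by
  simp [p, sub_div]

theorem p_smul (q : Coord n × Coord n) (c : ℝ) (X : Coord n) : d.p q (c • X) = c * d.p q X := by
  simp [p, mul_div_assoc]

/-- The radicand is positive off the zero section. Only existence of the derivative is extracted
from the square root; its value comes from `F_quadratic`. -/
theorem differentiableAt_F {q : Coord n × Coord n} (hq : q ∈ d.dom) :
    DifferentiableAt ℝ d.F q := by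
  obtain ⟨D, hD, -⟩ := d.deriv_h q.1 hq.1
  have hh := hD.differentiableAt
  have hW := (d.deriv_W q.1 hq.1).differentiableAt
  have h1 : DifferentiableAt ℝ (fun q : Coord n × Coord n => d.h q.1) q :=
    hh.comp q differentiableAt_fst
  have h2 : DifferentiableAt ℝ (fun q : Coord n × Coord n => d.W q.1) q :=
    hW.comp q differentiableAt_fst
  have h3 : DifferentiableAt ℝ (fun q : Coord n × Coord n => d.h q.1 (d.W q.1) q.2) q :=
    (h1.clm_apply h2).clm_apply differentiableAt_snd
  have h4 : DifferentiableAt ℝ (fun q : Coord n × Coord n => d.h q.1 q.2 q.2) q :=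
    (h1.clm_apply differentiableAt_snd).clm_apply differentiableAt_snd
  have h5 : DifferentiableAt ℝ (fun q : Coord n × Coord n => d.κ q.1) q :=
    (differentiableAt_const 1).sub ((h1.clm_apply h2).clm_apply h2)
  have h6 : DifferentiableAt ℝ d.μ q :=
    ((h3.pow 2).add (h4.mul h5)).sqrt (d.radicand_pos hq).ne'
  have h7 : DifferentiableAt ℝ (fun q : Coord n × Coord n => (d.κ q.1)⁻¹) q :=
    h5.inv (d.κ_pos hq.1).ne'
  exact ((h6.sub h3).mul h7).congr_of_eventuallyEq
    (Filter.EventuallyEq.of_eq (funext fun _ => div_eq_mul_inv _ _))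

/-- The variation of `F` in the direction `(X, Y)`. -/
def dF (q v : Coord n × Coord n) : ℝ :=
  d.p q (v.2 + d.Γ q.1 v.1 q.2 - (d.F q * d.a q.1) • d.J q.1 v.1)

theorem hasDirDeriv_F {q : Coord n × Coord n} (hq : q ∈ d.dom) :
    HasDirDeriv d.F q (d.dF q) := by
  obtain ⟨D, hD, hD'⟩ := d.deriv_h q.1 hq.1
  have hF := (d.differentiableAt_F hq).hasDirDeriv
  refine hF.congr_deriv fun v => ?_
  have h1 := hD.comp_fst (r := q)
  have hW := (d.deriv_W q.1 hq.1).comp_fst (r := q)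
  have hy := HasDirDeriv.snd (r := q)
  have e1 := (h1.clm_apply hy).clm_apply hy
  -- Both sides of `F_quadratic` are differentiated. The derivative of F enters with coefficient
  -- 2(κF + h(W, y)) = 2μ, which is nonzero and so determines it.
  have e2 : HasDirDeriv (fun q : Coord n × Coord n => d.h q.1 q.2 q.2) q _ :=
    (((((HasDirDeriv.const 1).sub ((h1.clm_apply hW).clm_apply hW)).mul (hF.mul hF)).add
      ((HasDirDeriv.const 2).mul (hF.mul ((h1.clm_apply hW).clm_apply hy))))).congr_of_eventuallyEq
      (Filter.eventuallyEq_of_mem (d.isOpen_dom.mem_nhds hq) fun z hz => by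
        have := d.F_quadratic hz
        simp only [κ] at this
        linear_combination -this)
  have key := e1.unique e2 v
  have h3 := d.μ_mul_p hq (v.2 + d.Γ q.1 v.1 q.2 - (d.F q * d.a q.1) • d.J q.1 v.1)
  apply mul_left_cancel₀ (d.μ_pos hq).ne'
  rw [dF, h3, d.μ_eq hq]
  simp only [κ, N, add_apply, sub_apply,
    smul_apply, hD', map_sub, map_add, map_smul, smul_eq_mul,
    d.h_symm q.1 (d.Γ q.1 v.1 (d.W q.1)) (d.W q.1), d.h_symm q.1 (d.Γ q.1 v.1 q.2),
    d.h_symm q.1 (d.J q.1 v.1), d.h_symm q.1 v.2] at key ⊢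
  linear_combination (-1/2) * key

end KillingData
end Finsler
end

/-! ### Metric tensor, geodesic coefficients and connection of the Randers function. -/

noncomputable section
namespace Finsler
namespace KillingData

variable {n : ℕ} {K : ℝ} (d : KillingData n K)

/-- The covariant variation of `N` in the direction `(X, Y)`. -/
def ν (q v : Coord n × Coord n) : Coord n :=
  v.2 + d.Γ q.1 v.1 q.2 - d.dF q v • d.W q.1 - (d.F q * d.a q.1) • d.J q.1 v.1

/-- Splitting off Γ(X, N) leaves the covariant part `ν`; when products h(N, ·) are differentiated,
the Christoffel terms of N then cancel against those of h. -/
theorem hasDirDeriv_N {q : Coord n × Coord n} (hq : q ∈ d.dom) :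
    HasDirDeriv d.N q (fun v => d.ν q v - d.Γ q.1 v.1 (d.N q)) := by
  refine (HasDirDeriv.snd.sub ((d.hasDirDeriv_F hq).smul
    (d.deriv_W q.1 hq.1).comp_fst)).congr_deriv fun v => ?_
  simp only [ν, N, map_sub, map_smul]
  module

/-- The variation of `μ` in the direction `(X, Y)`. -/
def dμ (q v : Coord n × Coord n) : ℝ :=
  d.dF q v + d.h q.1 (d.ν q v) (d.W q.1) + d.a q.1 * d.h q.1 (d.N q) (d.J q.1 v.1)

theorem hasDirDeriv_μ {q : Coord n × Coord n} (hq : q ∈ d.dom) :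
    HasDirDeriv d.μ q (d.dμ q) := by
  obtain ⟨D, hD, hD'⟩ := d.deriv_h q.1 hq.1
  refine (((d.hasDirDeriv_F hq).add (((hD.comp_fst (r := q)).clm_apply
    (d.hasDirDeriv_N hq)).clm_apply (d.deriv_W q.1 hq.1).comp_fst)).congr_of_eventuallyEq
    (Filter.eventuallyEq_of_mem (d.isOpen_dom.mem_nhds hq) fun z hz =>
      d.μ_eq_F_add hz)).congr_deriv fun v => ?_
  simp only [dμ, add_apply, hD', map_sub, map_smul, sub_apply, smul_eq_mul]
  ring

/-- The variation of `p(e)` in the direction `(X, Y)`. -/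
def dp (q : Coord n × Coord n) (e : Coord n) (v : Coord n × Coord n) : ℝ :=
  (d.h q.1 (d.ν q v) e + d.h q.1 (d.N q) (d.Γ q.1 v.1 e) - d.p q e * d.dμ q v) / d.μ q

theorem hasDirDeriv_h_N {q : Coord n × Coord n} (hq : q ∈ d.dom) (e : Coord n) :
    HasDirDeriv (fun q => d.h q.1 (d.N q) e) q
      (fun v => d.h q.1 (d.ν q v) e + d.h q.1 (d.N q) (d.Γ q.1 v.1 e)) := by
  obtain ⟨D, hD, hD'⟩ := d.deriv_h q.1 hq.1
  refine (((hD.comp_fst (r := q)).clm_apply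
    (d.hasDirDeriv_N hq)).clm_apply (HasDirDeriv.const e)).congr_deriv fun v => ?_
  simp only [add_apply, hD', map_sub, map_zero, sub_apply]
  ring

theorem hasDirDeriv_p {q : Coord n × Coord n} (hq : q ∈ d.dom) (e : Coord n) :
    HasDirDeriv (fun q => d.p q e) q (d.dp q e) := by
  have := (d.μ_pos hq).ne'
  refine ((d.hasDirDeriv_h_N hq e).div (d.hasDirDeriv_μ hq) this).congr_deriv fun v => ?_
  simp only [dp, p]
  field_simp

theorem hasDirDeriv_JN {q : Coord n × Coord n} (hq : q ∈ d.dom) :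
    HasDirDeriv (fun q => d.J q.1 (d.N q)) q
      (fun v => d.J q.1 (d.ν q v) - d.Γ q.1 v.1 (d.J q.1 (d.N q))) := by
  obtain ⟨D, hD, hD'⟩ := d.deriv_J q.1 hq.1
  refine ((hD.comp_fst (r := q)).clm_apply (d.hasDirDeriv_N hq)).congr_deriv fun v => ?_
  simp only [hD', map_sub]
  module

/-- The fundamental tensor. -/
def gt (q : Coord n × Coord n) (e e' : Coord n) : ℝ :=
  d.p q e * d.p q e' + d.F q / d.μ q *
    (d.h q.1 (e - d.p q e • d.W q.1) (e' - d.p q e' • d.W q.1) - d.p q e * d.p q e')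

/-- The geodesic coefficients. -/
def G (q : Coord n × Coord n) : Coord n :=
  (1 / 2 : ℝ) • d.Γ q.1 q.2 q.2 - (d.F q * d.a q.1) • d.J q.1 q.2
    + (1 / 2 * d.F q ^ 2 * d.a q.1) • d.J q.1 (d.W q.1)

/-- The nonlinear connection: the derivative of the geodesic coefficients in the fibre direction
`e`. -/
def conn (q : Coord n × Coord n) (e : Coord n) : Coord n :=
  d.Γ q.1 e q.2 - (d.F q * d.a q.1) • d.J q.1 e - (d.p q e * d.a q.1) • d.J q.1 (d.N q)

/-- The variation of `conn(e)`, given the variation `D` of the Christoffel symbols. -/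
def dconn (D : Coord n → Coord n → Coord n → Coord n) (q : Coord n × Coord n) (e : Coord n)
    (v : Coord n × Coord n) : Coord n :=
  D v.1 e q.2 + d.Γ q.1 e v.2
    - (d.dF q v * d.a q.1 - d.F q * (K * d.h q.1 (d.J q.1 v.1) (d.W q.1))) • d.J q.1 e
    - (d.F q * d.a q.1) • (d.J q.1 (d.Γ q.1 v.1 e) - d.Γ q.1 v.1 (d.J q.1 e))
    - (d.dp q e v * d.a q.1 - d.p q e * (K * d.h q.1 (d.J q.1 v.1) (d.W q.1))) • d.J q.1 (d.N q)
    - (d.p q e * d.a q.1) • (d.J q.1 (d.ν q v) - d.Γ q.1 v.1 (d.J q.1 (d.N q)))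

/-- Of the derivative D of Γ only the curvature combination is known, so D stays abstract. The
clause `D 0 = 0` removes it in fibre directions. -/
theorem hasDirDeriv_conn {q : Coord n × Coord n} (hq : q ∈ d.dom) :
    ∃ D : Coord n → Coord n → Coord n → Coord n,
      (∀ X Y Z, D X Y Z - D Y X Z + d.Γ q.1 X (d.Γ q.1 Y Z) - d.Γ q.1 Y (d.Γ q.1 X Z) =
        K • (d.h q.1 Y Z • X - d.h q.1 X Z • Y)) ∧
      D 0 = 0 ∧
      ∀ e, HasDirDeriv (fun q => d.conn q e) q (d.dconn D q e) := by
  obtain ⟨DΓ, hDΓ, hcurv⟩ := d.deriv_Γ q.1 hq.1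
  obtain ⟨DJ, hDJ, hDJ'⟩ := d.deriv_J q.1 hq.1
  refine ⟨fun X Y Z => DΓ X Y Z, hcurv, ?_, fun e => ?_⟩
  · obtain ⟨D', -, h'⟩ := hDΓ
    ext
    simp [← h']
  · have ha := (d.deriv_a q.1 hq.1).comp_fst (r := q)
    refine ((((hDΓ.comp_fst (r := q)).clm_apply (HasDirDeriv.const e)).clm_apply
      HasDirDeriv.snd).sub ((((d.hasDirDeriv_F hq).mul ha)).smul
      ((hDJ.comp_fst (r := q)).clm_apply (HasDirDeriv.const e))) |>.sub
      (((d.hasDirDeriv_p hq e).mul ha).smul (d.hasDirDeriv_JN hq))).congr_deriv fun v => ?_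
    simp only [dconn, hDJ', map_zero, add_zero]
    module

theorem dF_vert (q : Coord n × Coord n) (Y : Coord n) : d.dF q (0, Y) = d.p q Y := by
  simp [dF]

theorem ν_vert (q : Coord n × Coord n) (Y : Coord n) :
    d.ν q (0, Y) = Y - d.p q Y • d.W q.1 := by
  simp [ν, dF_vert]

theorem dμ_vert (q : Coord n × Coord n) (Y : Coord n) :
    d.dμ q (0, Y) = d.p q Y + d.h q.1 (Y - d.p q Y • d.W q.1) (d.W q.1) := by
  simp [dμ, dF_vert, ν_vert]

theorem hasDirDeriv_sq {q : Coord n × Coord n} (hq : q ∈ d.dom) :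
    HasDirDeriv (fun q => d.F q ^ 2) q (fun v => 2 * d.F q * d.dF q v) := by
  simp only [pow_two]
  exact ((d.hasDirDeriv_F hq).mul (d.hasDirDeriv_F hq)).congr_deriv fun v => by ring

theorem hasDirDeriv_Fp {q : Coord n × Coord n} (hq : q ∈ d.dom) (e : Coord n) :
    HasDirDeriv (fun q => d.F q * d.p q e) q
      (fun v => d.dF q v * d.p q e + d.F q * d.dp q e v) :=
  (d.hasDirDeriv_F hq).mul (d.hasDirDeriv_p hq e)

/-- F p is half the fibre derivative of F², so its own fibre derivative is the fundamental tensor.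
-/
theorem gt_eq {q : Coord n × Coord n} (hq : q ∈ d.dom) (e e' : Coord n) :
    d.dF q (0, e) * d.p q e' + d.F q * d.dp q e' (0, e) = d.gt q e e' := by
  have hμ := (d.μ_pos hq).ne'
  have h1 := d.μ_mul_p hq e
  have h1' := d.μ_mul_p hq e'
  simp only [dF_vert, dp, dμ_vert, ν_vert, gt, map_sub, map_smul, sub_apply, smul_apply,
    smul_eq_mul, map_zero, zero_apply, add_zero]
  field_simp
  rw [d.h_symm q.1 (d.W q.1) e']
  ring

/-- Only fibre directions matter; there the terms produced by differentiating F combine through Jy -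
F JW = JN. -/
theorem hasDirDeriv_G {q : Coord n × Coord n} (hq : q ∈ d.dom) :
    ∃ D, HasDirDeriv d.G q D ∧ ∀ e, D (0, e) = d.conn q e := by
  obtain ⟨DΓ, hDΓ, -⟩ := d.deriv_Γ q.1 hq.1
  obtain ⟨DJ, hDJ, -⟩ := d.deriv_J q.1 hq.1
  have ha := (d.deriv_a q.1 hq.1).comp_fst (r := q)
  have hW := (d.deriv_W q.1 hq.1).comp_fst (r := q)
  have hΓ := hDΓ.comp_fst (r := q)
  have hJ := hDJ.comp_fst (r := q)
  have hF := d.hasDirDeriv_F hq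
  refine ⟨_, ((((HasDirDeriv.const (1 / 2 : ℝ)).smul ((hΓ.clm_apply HasDirDeriv.snd).clm_apply
    HasDirDeriv.snd)).sub ((hF.mul ha).smul (hJ.clm_apply HasDirDeriv.snd))).add
    ((((HasDirDeriv.const (1 / 2 : ℝ)).mul (d.hasDirDeriv_sq hq)).mul ha).smul
      (hJ.clm_apply hW))), fun e => ?_⟩
  have h0 : ∀ (V : Type) [NormedAddCommGroup V] [NormedSpace ℝ V] (f : Coord n → V)
      (D : Coord n → V), HasDirDeriv f q.1 D → D 0 = 0 := by
    rintro V _ _ f D ⟨D', -, h'⟩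
    rw [← h', map_zero]
  simp only [h0 _ _ _ hDΓ, h0 _ _ _ hDJ, dF_vert, map_zero, zero_apply, conn, N, map_sub, map_smul,
    zero_add, smul_zero, mul_zero, neg_zero, zero_smul, d.Γ_symm q.1 q.2 e]
  module

/-- The left side is the contraction of metric derivatives that defines the geodesic coefficients,
before the inverse metric is applied. Writing G as half of V - F a JN, with V = Γ(y, y) - F a Jy,
makes the JN terms drop out of p(G). -/
theorem gt_geodesic {q : Coord n × Coord n} (hq : q ∈ d.dom) (e : Coord n) :
    2 * (d.dF q (q.2, 0) * d.p q e + d.F q * d.dp q e (q.2, 0)) - 2 * d.F q * d.dF q (e, 0)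
      = 4 * d.gt q (d.G q) e := by
  obtain ⟨V, hV⟩ : ∃ V, V = d.Γ q.1 q.2 q.2 - (d.F q * d.a q.1) • d.J q.1 q.2 := ⟨_, rfl⟩
  have hG : d.G q = (1 / 2 : ℝ) • (V - (d.F q * d.a q.1) • d.J q.1 (d.N q)) := by
    simp only [hV, G, N, map_sub, map_smul]
    module
  have hf : d.dF q (q.2, 0) = d.p q V := by simp only [dF, zero_add, hV]
  have hν : d.ν q (q.2, 0) = V - d.p q V • d.W q.1 := by
    simp only [ν, hf, hV]
    module
  have hpG : d.p q (d.G q) = 1 / 2 * d.p q V := by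
    rw [hG, p_smul, p_sub, p_smul, d.p_JN hq]
    ring
  have hμ := (d.μ_pos hq).ne'
  have hpe := d.μ_mul_p hq e
  have hJy : d.h q.1 (d.N q) (d.J q.1 q.2) = d.F q * d.h q.1 (d.N q) (d.J q.1 (d.W q.1)) := by
    have := d.h_J_self hq.1 (d.N q)
    nth_rw 2 [N] at this
    simp only [map_sub, map_smul, smul_eq_mul] at this
    linarith
  have hfe : d.μ q * d.dF q (e, 0) = d.h q.1 (d.N q) (d.Γ q.1 q.2 e)
      - d.F q * d.a q.1 * d.h q.1 (d.N q) (d.J q.1 e) := by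
    rw [dF, d.μ_mul_p hq, d.Γ_symm q.1 q.2 e]
    simp
  simp only [gt, dp, dμ, hν, hpG, hf, hJy]
  rw [hG]
  simp only [map_sub, map_smul, sub_apply, smul_apply, smul_eq_mul, d.J_skew q.1 hq.1]
  apply mul_left_cancel₀ hμ
  field_simp
  linear_combination (-4 * d.F q) * hfe

end KillingData
end Finsler
end

/-! ### Curvature, the parallel vertical field, and positivity of the metric tensor. -/

noncomputable section
namespace Finsler
namespace KillingData

variable {n : ℕ} {K : ℝ} (d : KillingData n K)

/-- Along a horizontal direction the argument of p in `dF` reduces to a multiple of JN, which p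
annihilates. -/
theorem dF_horizontal {q : Coord n × Coord n} (hq : q ∈ d.dom) (X : Coord n) :
    d.dF q (X, -d.conn q X) = 0 := by
  have : -d.conn q X + d.Γ q.1 X q.2 - (d.F q * d.a q.1) • d.J q.1 X =
      (d.p q X * d.a q.1) • d.J q.1 (d.N q) := by
    simp only [conn]
    module
  simp only [dF, this, p_smul, d.p_JN hq, mul_zero]

theorem ν_horizontal {q : Coord n × Coord n} (hq : q ∈ d.dom) (X : Coord n) :
    d.ν q (X, -d.conn q X) = (d.p q X * d.a q.1) • d.J q.1 (d.N q) := by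
  simp only [ν, d.dF_horizontal hq]
  simp only [conn]
  module

theorem dμ_horizontal {q : Coord n × Coord n} (hq : q ∈ d.dom) (X : Coord n) :
    d.dμ q (X, -d.conn q X) = d.a q.1 *
      (d.p q X * d.h q.1 (d.J q.1 (d.N q)) (d.W q.1) - d.h q.1 (d.J q.1 (d.N q)) X) := by
  simp only [dμ, d.dF_horizontal hq, d.ν_horizontal hq, d.J_skew q.1 hq.1, map_smul, smul_apply,
    smul_eq_mul]
  ring

/-- Every term is visibly symmetric once the horizontal variations of N and μ are inserted. As a
result the derivatives of p cancel in the curvature. -/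
theorem dp_horizontal_symm {q : Coord n × Coord n} (hq : q ∈ d.dom) (X Y : Coord n) :
    d.dp q Y (X, -d.conn q X) = d.dp q X (Y, -d.conn q Y) := by
  simp only [dp, d.dμ_horizontal hq, d.ν_horizontal hq, map_smul, smul_apply, smul_eq_mul,
    d.Γ_symm q.1 Y X]
  ring

/-- The curvature of h contributes K(h(X, y)Y - h(Y, y)X). With y = N + FW this splits into μ(p(X)Y
- p(Y)X) and a W part (`e3`). The derivative of a cancels the W part (`e1`) and subtracts h(N, W)
from the factor μ (`e2`), leaving μ - h(N, W) = F. -/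
theorem curvature_eq {q : Coord n × Coord n} (hq : q ∈ d.dom)
    {D : Coord n → Coord n → Coord n → Coord n}
    (hD : ∀ X Y Z, D X Y Z - D Y X Z + d.Γ q.1 X (d.Γ q.1 Y Z) - d.Γ q.1 Y (d.Γ q.1 X Z) =
        K • (d.h q.1 Y Z • X - d.h q.1 X Z • Y)) (X Y : Coord n) :
    d.dconn D q X (Y, -d.conn q Y) - d.dconn D q Y (X, -d.conn q X) =
      K • (d.F q • (d.p q X • Y - d.p q Y • X)) := by
  have hN : q.2 = d.N q + d.F q • d.W q.1 := by
    simp only [N]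
    module
  have c := hD Y X q.2
  have hX := d.μ_mul_p hq X
  have hY := d.μ_mul_p hq Y
  have e1 : d.h q.1 (d.J q.1 Y) (d.W q.1) • d.J q.1 X - d.h q.1 (d.J q.1 X) (d.W q.1) • d.J q.1 Y =
    d.h q.1 (d.W q.1) Y • X - d.h q.1 (d.W q.1) X • Y := by
    have h1 := d.wedge q.1 hq.1 X Y (d.W q.1)
    have h2 := d.wedge q.1 hq.1 Y X (d.W q.1)
    rw [d.h_symm q.1 Y X] at h2
    rw [← h1, ← h2, d.h_symm q.1 X (d.W q.1), d.h_symm q.1 Y (d.W q.1)]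
    module
  have e2 : (d.p q X * d.h q.1 (d.J q.1 Y) (d.W q.1) - d.p q Y * d.h q.1 (d.J q.1 X) (d.W q.1)) •
      d.J q.1 (d.N q) = - d.h q.1 (d.N q) (d.W q.1) • (d.p q X • Y - d.p q Y • X) := by
    have h1 := d.wedge q.1 hq.1 (d.N q) Y (d.W q.1)
    have h2 := d.wedge q.1 hq.1 (d.N q) X (d.W q.1)
    rw [sub_smul, mul_smul, mul_smul, ← h1, ← h2, ← hX, ← hY]
    module
  have e3 : d.h q.1 X q.2 • Y - d.h q.1 Y q.2 • X = d.μ q • (d.p q X • Y - d.p q Y • X)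
      + d.F q • (d.h q.1 (d.W q.1) X • Y - d.h q.1 (d.W q.1) Y • X) := by
    rw [hN]
    simp only [map_add, map_smul, smul_eq_mul, d.h_symm q.1 X, d.h_symm q.1 Y, add_apply,
      smul_apply]
    rw [← hX, ← hY]
    module
  have e4 := d.μ_eq_F_add hq
  rw [e3, e4] at c
  simp only [dconn, d.dF_horizontal hq, d.ν_horizontal hq, d.dp_horizontal_symm hq X Y,
    map_neg, map_smul, d.J_sq q.1 hq.1, d.Γ_symm q.1 Y X]
  simp only [conn, map_sub, map_smul]
  linear_combination (norm := module) c + (K * d.F q) • e1 + K • e2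

/-- The vertical field `(F / μ) J N` spanning the curvature algebra. -/
def vert (q : Coord n × Coord n) : Coord n := (d.F q / d.μ q) • d.J q.1 (d.N q)

/-- The variation of `vert`. -/
def dvert (q v : Coord n × Coord n) : Coord n :=
  (d.dF q v / d.μ q - d.F q * d.dμ q v / d.μ q ^ 2) • d.J q.1 (d.N q) +
    (d.F q / d.μ q) • (d.J q.1 (d.ν q v) - d.Γ q.1 v.1 (d.J q.1 (d.N q)))

theorem hasDirDeriv_vert {q : Coord n × Coord n} (hq : q ∈ d.dom) :
    HasDirDeriv d.vert q (d.dvert q) :=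
  ((d.hasDirDeriv_F hq).div (d.hasDirDeriv_μ hq) (d.μ_pos hq).ne').smul (d.hasDirDeriv_JN hq)

/-- This says that `vert` is Berwald parallel. The first term is its horizontal derivative; the
second is the contraction of the Berwald coefficients with it, that is, the variation of `conn`
along `vert`. -/
theorem dvert_add_dconn {q : Coord n × Coord n} (hq : q ∈ d.dom)
    {D : Coord n → Coord n → Coord n → Coord n} (hD : D 0 = 0) (X : Coord n) (c : ℝ) :
    c • d.dvert q (X, -d.conn q X) + d.dconn D q X (0, c • d.vert q) = 0 := by
  have hμ := (d.μ_pos hq).ne'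
  have h1 : d.p q (c • d.vert q) = 0 := by
    rw [p_smul, vert, p_smul, d.p_JN hq]
    ring
  have h2 : d.dp q X (0, c • d.vert q) = c * d.F q / d.μ q ^ 2 *
      (d.h q.1 (d.J q.1 (d.N q)) X - d.p q X * d.h q.1 (d.J q.1 (d.N q)) (d.W q.1)) := by
    simp only [dp, ν_vert, dμ_vert, h1]
    simp only [vert, map_smul, smul_apply, map_zero, zero_apply, zero_smul, sub_zero, smul_eq_mul]
    field_simp
    ring
  simp only [dvert, dconn, d.dF_horizontal hq, d.ν_horizontal hq, d.dμ_horizontal hq, h2, hD,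
    d.dF_vert, d.ν_vert, h1]
  simp only [vert, Pi.zero_apply, map_smul, map_zero, zero_apply, d.J_sq q.1 hq.1, zero_smul,
    sub_zero]
  module

theorem p_self {q : Coord n × Coord n} (hq : q ∈ d.dom) : d.p q q.2 = d.F q := by
  apply mul_left_cancel₀ (d.μ_pos hq).ne'
  rw [d.μ_mul_p hq, d.μ_eq_F_add hq]
  have hN : q.2 = d.N q + d.F q • d.W q.1 := by
    simp only [N]
    module
  nth_rw 1 [hN]
  rw [map_add, d.h_N_N hq, map_smul, smul_eq_mul]
  ring

theorem gt_self {q : Coord n × Coord n} (hq : q ∈ d.dom) (e : Coord n) :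
    d.gt q q.2 e = d.F q * d.p q e := by
  have h1 := d.μ_mul_p hq e
  rw [d.μ_eq_F_add hq] at h1
  have h2 : d.h q.1 (q.2 - d.F q • d.W q.1) (e - d.p q e • d.W q.1) = d.F q * d.p q e := by
    change d.h q.1 (d.N q) _ = _
    rw [map_sub, map_smul, smul_eq_mul]
    linear_combination -h1
  rw [gt, d.p_self hq, h2]
  ring

/-- For z = e - p(e)W one has h(N, z) = F p(e) and h(N, N) = F², so Cauchy–Schwarz gives p(e)² ≤
h(z, z). Thus both summands of `gt` are nonnegative. The first is positive if p(e) ≠ 0; otherwise z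
= e and the second is. -/
theorem gt_pos {q : Coord n × Coord n} (hq : q ∈ d.dom) {e : Coord n} (he : e ≠ 0) :
    0 < d.gt q e e := by
  have hμ := d.μ_pos hq
  have hF := d.F_pos hq
  obtain ⟨z, hz⟩ : ∃ z, z = e - d.p q e • d.W q.1 := ⟨_, rfl⟩
  have h1 := d.μ_mul_p hq e
  have h2 : d.h q.1 (d.N q) z = d.F q * d.p q e := by
    rw [d.μ_eq_F_add hq] at h1
    rw [hz, map_sub, map_smul, smul_eq_mul]
    linear_combination -h1
  have h3 : d.p q e ^ 2 ≤ d.h q.1 z z := by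
    by_contra! hlt
    have h4 : d.F q ^ 2 * d.h q.1 z z < d.F q ^ 2 * d.p q e ^ 2 := by gcongr
    have h5 : d.h q.1 (d.F q • z - d.p q e • d.N q) (d.F q • z - d.p q e • d.N q) < 0 := by
      simp only [map_sub, map_smul, sub_apply, smul_apply, smul_eq_mul, d.h_N_N hq, h2,
        d.h_symm q.1 z (d.N q)]
      linarith
    by_cases h6 : d.F q • z - d.p q e • d.N q = 0
    · simp [h6] at h5
    · exact absurd (d.h_pos q.1 hq.1 _ h6) (not_lt.2 h5.le)
  rw [gt, ← hz]
  by_cases hp : d.p q e = 0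
  · have : z = e := by simp [hz, hp]
    rw [hp, this]
    have := d.h_pos q.1 hq.1 e he
    have h7 := div_pos hF hμ
    have := mul_pos h7 this
    linarith
  · have h8 : 0 < d.p q e ^ 2 := by positivity
    have h9 : 0 ≤ d.F q / d.μ q * (d.h q.1 z z - d.p q e * d.p q e) :=
      mul_nonneg (div_pos hF hμ).le (by linarith)
    nlinarith

end KillingData
end Finsler
end

/-! ### Identification with the coordinate formulas for the Finsler coefficients. -/

noncomputable section
namespace Finsler

theorem HasDirDeriv.map_add {E V : Type*} [NormedAddCommGroup E] [NormedSpace ℝ E]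
    [NormedAddCommGroup V] [NormedSpace ℝ V] {f d : E → V} {q : E} (h : HasDirDeriv f q d)
    (v w : E) : d (v + w) = d v + d w := by
  obtain ⟨D, -, hd⟩ := h
  simp only [← hd, _root_.map_add]

theorem HasDirDeriv.map_neg {E V : Type*} [NormedAddCommGroup E] [NormedSpace ℝ E]
    [NormedAddCommGroup V] [NormedSpace ℝ V] {f d : E → V} {q : E} (h : HasDirDeriv f q d)
    (v : E) : d (-v) = - d v := by
  obtain ⟨D, -, hd⟩ := h
  simp only [← hd, _root_.map_neg]

theorem HasDirDeriv.sum {E V : Type*} [NormedAddCommGroup E] [NormedSpace ℝ E]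
    [NormedAddCommGroup V] [NormedSpace ℝ V] {n : ℕ} {f d : Fin n → E → V} {q : E}
    (h : ∀ i, HasDirDeriv (f i) q (d i)) :
    HasDirDeriv (fun z => ∑ i, f i z) q (fun v => ∑ i, d i v) := by
  choose D hD hd using h
  exact ⟨_, HasFDerivAt.fun_sum fun i _ => hD i, fun v => by simp [hd]⟩

theorem Coord.sum_single {n : ℕ} (y : Coord n) :
    ∑ i, y i • (EuclideanSpace.single i 1 : Coord n) = y := by
  ext j
  simp [Pi.single_apply]

theorem HasDirDeriv.sum_fst {V E' : Type*} [NormedAddCommGroup V] [NormedSpace ℝ V]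
    [NormedAddCommGroup E'] [NormedSpace ℝ E'] {n : ℕ} {f d : Coord n × E' → V} {q : Coord n × E'}
    (h : HasDirDeriv f q d) (X : Coord n) :
    ∑ i, X i • d (EuclideanSpace.single i 1, 0) = d (X, 0) := by
  obtain ⟨D, -, hd⟩ := h
  have : (X, (0 : E')) = ∑ i, X i • ((EuclideanSpace.single i 1 : Coord n), (0 : E')) := by
    ext1
    · simp [Prod.fst_sum, Coord.sum_single]
    · simp [Prod.snd_sum]
  simp only [← hd, ← map_smul, ← _root_.map_sum, this]

theorem HasDirDeriv.sum_snd {V E' : Type*} [NormedAddCommGroup V] [NormedSpace ℝ V]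
    [NormedAddCommGroup E'] [NormedSpace ℝ E'] {n : ℕ} {f d : E' × Coord n → V} {q : E' × Coord n}
    (h : HasDirDeriv f q d) (X : Coord n) :
    ∑ i, X i • d (0, EuclideanSpace.single i 1) = d (0, X) := by
  obtain ⟨D, -, hd⟩ := h
  have : ((0 : E'), X) = ∑ i, X i • ((0 : E'), (EuclideanSpace.single i 1 : Coord n)) := by
    ext1
    · simp [Prod.fst_sum]
    · simp [Prod.snd_sum, Coord.sum_single]
  simp only [← hd, ← map_smul, ← _root_.map_sum, this]

namespace KillingData

variable {n : ℕ} {K : ℝ} (d : KillingData n K)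

local notation "ε" => fun i => EuclideanSpace.single i (1 : ℝ)

/-- Agreement on the slice of fixed y suffices. This is needed because contractions with the
constant components of y simplify, by homogeneity, only on that slice. -/
theorem horizontal_congr {q : Coord n × Coord n} (hq : q ∈ d.dom)
    {f f' D D' : Coord n × Coord n → ℝ} (h : HasDirDeriv f q D) (h' : HasDirDeriv f' q D')
    (hff : ∀ u ∈ d.U, f (u, q.2) = f' (u, q.2)) (X : Coord n) : D (X, 0) = D' (X, 0) := by
  have h2 : HasDirDeriv (fun z : Coord n => (z, q.2)) q.1 (fun v => (v, 0)) :=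
    ⟨_, (hasFDerivAt_id q.1).prodMk (hasFDerivAt_const q.2 q.1), fun v => rfl⟩
  have e1 := HasDirDeriv.comp (k := fun z : Coord n => (z, q.2)) (q' := q.1) h h2
  have e2 := HasDirDeriv.comp (k := fun z : Coord n => (z, q.2)) (q' := q.1) h' h2
  exact (e1.congr_of_eventuallyEq (Filter.eventuallyEq_of_mem (d.isOpen_U.mem_nhds hq.1)
    fun u hu => (hff u hu).symm)).unique e2 X

theorem hasDirDeriv_gt {q : Coord n × Coord n} (hq : q ∈ d.dom) (e e' : Coord n) :
    ∃ D, HasDirDeriv (fun q => d.gt q e e') q D := by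
  obtain ⟨Dh, hDh, -⟩ := d.deriv_h q.1 hq.1
  have hW := (d.deriv_W q.1 hq.1).comp_fst (r := q)
  have hp := d.hasDirDeriv_p hq e
  have hp' := d.hasDirDeriv_p hq e'
  exact ⟨_, (hp.mul hp').add (((d.hasDirDeriv_F hq).div (d.hasDirDeriv_μ hq)
    (d.μ_pos hq).ne').mul (((hDh.comp_fst.clm_apply ((HasDirDeriv.const e).sub
      (hp.smul hW))).clm_apply ((HasDirDeriv.const e').sub (hp'.smul hW))).sub (hp.mul hp')))⟩

theorem gt_symm (q : Coord n × Coord n) (e e' : Coord n) : d.gt q e e' = d.gt q e' e := by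
  rw [gt, gt, d.h_symm]
  ring

theorem gt_sum {q : Coord n × Coord n} (hq : q ∈ d.dom) (w e : Coord n) :
    ∑ i, w i * d.gt q (ε i) e = d.gt q w e := by
  have := (d.hasDirDeriv_Fp hq e).sum_snd w
  simpa only [smul_eq_mul, d.gt_eq hq] using this

theorem p_sum (q : Coord n × Coord n) (w : Coord n) : ∑ i, w i * d.p q (ε i) = d.p q w := by
  nth_rw 2 [← Coord.sum_single w]
  simp only [p, map_sum, map_smul, smul_eq_mul, Finset.sum_div, mul_div_assoc]

variable {L : Coord n → Coord n → ℝ} (hL : ∀ q ∈ d.dom, L q.1 q.2 = d.F q)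

include hL

theorem dY_sq_eq {q : Coord n × Coord n} (hq : q ∈ d.dom) (j : Fin n) :
    dY j (fun u y => L u y ^ 2) q.1 q.2 = 2 * (d.F q * d.p q (ε j)) := by
  rw [dY_eq_of_hasDirDeriv d.isOpen_dom (fun z hz => by rw [hL z hz]) hq (d.hasDirDeriv_sq hq),
    dF_vert]
  ring

theorem fundTensor_eq {q : Coord n × Coord n} (hq : q ∈ d.dom) (i j : Fin n) :
    fundTensor L i j q.1 q.2 = d.gt q (ε i) (ε j) := by
  rw [fundTensor, dY_eq_of_hasDirDeriv d.isOpen_dom (fun z hz => d.dY_sq_eq hL hz j) hq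
    ((HasDirDeriv.const 2).mul (d.hasDirDeriv_Fp hq _)), d.gt_eq hq]
  ring

/-- Homogeneity gives g_{jl} yʲ = F p_l and F p_k yᵏ = F². Differentiating these with y fixed turns
the double sum into the left side of `gt_geodesic`. -/
theorem sum_dX_fundTensor {q : Coord n × Coord n} (hq : q ∈ d.dom) (l : Fin n) :
    ∑ j, ∑ k, (2 * dX k (fundTensor L j l) q.1 q.2 - dX l (fundTensor L j k) q.1 q.2)
      * q.2 j * q.2 k = 4 * d.gt q (d.G q) (ε l) := by
  choose D hD using fun e e' => d.hasDirDeriv_gt hq e e'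
  have h1 : ∀ j k l, dX k (fundTensor L j l) q.1 q.2 = D (ε j) (ε l) (ε k, 0) := fun j k l =>
    dX_eq_of_hasDirDeriv d.isOpen_dom (fun z hz => d.fundTensor_eq hL hz j l) hq (hD _ _) k
  have h2 : ∀ l X, ∑ j, q.2 j * D (ε j) (ε l) (X, 0) =
      d.dF q (X, 0) * d.p q (ε l) + d.F q * d.dp q (ε l) (X, 0) := by
    intro l X
    have e1 := HasDirDeriv.sum fun j => (HasDirDeriv.const (q.2 j)).mul (hD (ε j) (ε l))
    have := d.horizontal_congr hq e1 (d.hasDirDeriv_Fp hq (ε l)) (fun u hu => by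
      have hu' : (u, q.2) ∈ d.dom := ⟨hu, hq.2⟩
      rw [d.gt_sum hu' q.2 (ε l), d.gt_self hu']) X
    simpa using this
  have h3 : ∀ X, ∑ k, q.2 k * (d.dF q (X, 0) * d.p q (ε k) + d.F q * d.dp q (ε k) (X, 0)) =
      2 * d.F q * d.dF q (X, 0) := by
    intro X
    have e1 := HasDirDeriv.sum fun k => (HasDirDeriv.const (q.2 k)).mul (d.hasDirDeriv_Fp hq (ε k))
    have := d.horizontal_congr hq e1 (d.hasDirDeriv_sq hq) (fun u hu => by
      have hu' : (u, q.2) ∈ d.dom := ⟨hu, hq.2⟩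
      simp only [mul_left_comm _ (d.F (u, q.2))]
      rw [← Finset.mul_sum, d.p_sum, d.p_self hu', sq]) X
    simpa using this
  have h4 : ∑ k, q.2 k * (d.dF q (ε k, 0) * d.p q (ε l) + d.F q * d.dp q (ε l) (ε k, 0)) =
      d.dF q (q.2, 0) * d.p q (ε l) + d.F q * d.dp q (ε l) (q.2, 0) :=
    (d.hasDirDeriv_Fp hq (ε l)).sum_fst q.2
  rw [← d.gt_geodesic hq, ← h4, ← h3 (ε l)]
  simp only [h1, ← h2]
  rw [Finset.sum_comm, Finset.mul_sum, ← Finset.sum_sub_distrib]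
  refine Finset.sum_congr rfl fun k _ => ?_
  rw [Finset.mul_sum, Finset.mul_sum, Finset.mul_sum, ← Finset.sum_sub_distrib]
  refine Finset.sum_congr rfl fun j _ => ?_
  ring

/-- The metric matrix sends G to the contraction computed in `sum_dX_fundTensor`, up to the factor
4, and is invertible by `gt_pos`; no explicit inverse is required. -/
theorem geodCoeff_eq {q : Coord n × Coord n} (hq : q ∈ d.dom) (i : Fin n) :
    geodCoeff L i q.1 q.2 = d.G q i := by
  obtain ⟨M, hM⟩ : ∃ M : Matrix (Fin n) (Fin n) ℝ,
    M = Matrix.of fun a b => d.gt q (ε a) (ε b) := ⟨_, rfl⟩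
  have h1 : ∀ w : Coord n, M.mulVec w = fun l => d.gt q w (ε l) := by
    intro w
    ext l
    rw [← d.gt_sum hq]
    simp only [Matrix.mulVec, dotProduct, hM, Matrix.of_apply]
    exact Finset.sum_congr rfl fun j _ => by rw [d.gt_symm, mul_comm]
  have h2 : IsUnit M.det := by
    rw [← Matrix.isUnit_iff_isUnit_det, ← Matrix.mulVec_injective_iff_isUnit,
      ← Matrix.coe_mulVecLin, injective_iff_map_eq_zero]
    intro w hw
    by_contra hw0
    have h3 : M.mulVec w = 0 := hw
    have h4 := d.gt_pos hq (e := WithLp.toLp 2 w) (by simpa using hw0)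
    have h5 := d.gt_sum hq (WithLp.toLp 2 w) (WithLp.toLp 2 w)
    have h6 := h1 (WithLp.toLp 2 w)
    rw [show M.mulVec (WithLp.toLp 2 w : Coord n) = 0 from h3] at h6
    rw [← h5] at h4
    refine h4.ne' (Finset.sum_eq_zero fun i _ => ?_)
    rw [d.gt_symm, ← congrFun h6 i]
    simp
  have h3 : (Matrix.of fun a b => fundTensor L a b q.1 q.2) = M := by
    simp only [d.fundTensor_eq hL hq, hM]
  have h4 := congrFun (congrArg (M⁻¹.mulVec ·) (h1 (d.G q))) i
  simp only [Matrix.mulVec_mulVec, Matrix.nonsing_inv_mul _ h2, Matrix.one_mulVec] at h4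
  rw [geodCoeff, h4]
  simp only [fundTensorInv, h3, d.sum_dX_fundTensor hL hq, Matrix.mulVec, dotProduct]
  rw [Finset.mul_sum]
  exact Finset.sum_congr rfl fun l _ => by ring

theorem connCoeff_eq {q : Coord n × Coord n} (hq : q ∈ d.dom) (i j : Fin n) :
    connCoeff L i j q.1 q.2 = d.conn q (ε j) i := by
  obtain ⟨D, hD, hD'⟩ := d.hasDirDeriv_G hq
  rw [connCoeff, dY_eq_of_hasDirDeriv d.isOpen_dom (fun z hz => d.geodCoeff_eq hL hz i) hq
    (hD.coord i), hD']

theorem berwaldCoeff_eq {q : Coord n × Coord n} (hq : q ∈ d.dom) {j : Fin n}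
    {D : Coord n × Coord n → Coord n} (hD : HasDirDeriv (fun q => d.conn q (ε j)) q D)
    (i k : Fin n) : berwaldCoeff L i j k q.1 q.2 = D (0, ε k) i := by
  rw [berwaldCoeff, dY_eq_of_hasDirDeriv d.isOpen_dom (fun z hz => d.connCoeff_eq hL hz i j) hq
    (hD.coord i)]

theorem dX_connCoeff_eq {q : Coord n × Coord n} (hq : q ∈ d.dom) {j : Fin n}
    {D : Coord n × Coord n → Coord n} (hD : HasDirDeriv (fun q => d.conn q (ε j)) q D)
    (i k : Fin n) : dX k (connCoeff L i j) q.1 q.2 = D (ε k, 0) i := by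
  rw [dX_eq_of_hasDirDeriv d.isOpen_dom (fun z hz => d.connCoeff_eq hL hz i j) hq (hD.coord i)]

theorem curvCoeff_eq {q : Coord n × Coord n} (hq : q ∈ d.dom) (i j k : Fin n) :
    curvCoeff L i j k q.1 q.2 =
      K * (d.F q * (d.p q (ε j) * (ε k : Coord n) i - d.p q (ε k) * (ε j : Coord n) i)) := by
  obtain ⟨D, hD, -, hD'⟩ := d.hasDirDeriv_conn hq
  have h1 := congrArg (· i) (d.curvature_eq hq hD (ε j) (ε k))
  simp only [PiLp.sub_apply, PiLp.smul_apply, smul_eq_mul] at h1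
  rw [← h1, curvCoeff]
  have h2 : ∀ j X Y, d.dconn D q (ε j) (X, -Y) i =
      d.dconn D q (ε j) (X, 0) i - ∑ m, Y m * d.dconn D q (ε j) (0, ε m) i := by
    intro j X Y
    have e1 := (hD' (ε j)).coord i
    have e2 := e1.sum_snd Y
    simp only [smul_eq_mul] at e2
    rw [e2, sub_eq_add_neg, ← e1.map_neg, ← e1.map_add]
    simp
  rw [h2, h2, d.dX_connCoeff_eq hL hq (hD' _), d.dX_connCoeff_eq hL hq (hD' _)]
  simp only [d.berwaldCoeff_eq hL hq (hD' _), d.connCoeff_eq hL hq, Finset.sum_sub_distrib]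
  ring

theorem sum_fundTensor_eq {q : Coord n × Coord n} (hq : q ∈ d.dom) (j : Fin n) :
    ∑ m, fundTensor L j m q.1 q.2 * q.2 m = d.F q * d.p q (ε j) := by
  rw [← d.gt_self hq, ← d.gt_sum hq]
  refine Finset.sum_congr rfl fun m _ => ?_
  rw [d.fundTensor_eq hL hq, d.gt_symm, mul_comm]

theorem sum_sum_fundTensor_eq {q : Coord n × Coord n} (hq : q ∈ d.dom) (w : Coord n) :
    ∑ i, ∑ j, fundTensor L i j q.1 q.2 * w i * w j = d.gt q w w := by
  rw [← d.gt_sum hq]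
  refine Finset.sum_congr rfl fun i _ => ?_
  rw [d.gt_symm, ← d.gt_sum hq, Finset.mul_sum]
  refine Finset.sum_congr rfl fun j _ => ?_
  rw [d.fundTensor_eq hL hq, d.gt_symm]
  ring

/-- Product rule: since `vert` is parallel, only the derivative of the base function f survives. -/
theorem berwaldDeriv_eq {q : Coord n × Coord n} (hq : q ∈ d.dom) (X : Coord n)
    {f : Coord n → ℝ} {df : Coord n → ℝ} (hf : HasDirDeriv f q.1 df)
    {ξ : Coord n → Coord n → Coord n} (hξ : ∀ q ∈ d.dom, ξ q.1 q.2 = f q.1 • d.vert q) :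
    berwaldDeriv L X ξ q.1 q.2 = df X • d.vert q := by
  obtain ⟨D, -, hD0, hD'⟩ := d.hasDirDeriv_conn hq
  have h1 := (hf.comp_fst (r := q)).smul (d.hasDirDeriv_vert hq)
  ext i
  have h2 : ∀ j, dX j (fun u y => ξ u y i) q.1 q.2 = _ := fun j =>
    dX_eq_of_hasDirDeriv d.isOpen_dom (fun z hz => by rw [hξ z hz]) hq (h1.coord i) j
  have h3 : ∀ j, dY j (fun u y => ξ u y i) q.1 q.2 = _ := fun j =>
    dY_eq_of_hasDirDeriv d.isOpen_dom (fun z hz => by rw [hξ z hz]) hq (h1.coord i) j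
  have h4 : ∀ j, d.dvert q (ε j, 0) i - ∑ k, d.conn q (ε j) k * d.dvert q (0, ε k) i =
      d.dvert q (ε j, -d.conn q (ε j)) i := by
    intro j
    have e1 := (d.hasDirDeriv_vert hq).coord i
    have e2 := e1.sum_snd (d.conn q (ε j))
    simp only [smul_eq_mul] at e2
    rw [e2, sub_eq_add_neg, ← e1.map_neg, ← e1.map_add]
    simp
  have h5 : ∀ j, ∑ k, d.dconn D q (ε j) (0, ε k) i * ξ q.1 q.2 k =
      d.dconn D q (ε j) (0, f q.1 • d.vert q) i := by
    intro j
    have e2 := ((hD' (ε j)).coord i).sum_snd (ξ q.1 q.2)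
    simp only [smul_eq_mul] at e2
    rw [← hξ q hq, ← e2]
    exact Finset.sum_congr rfl fun k _ => mul_comm _ _
  have h6 : df 0 = 0 := by
    obtain ⟨D', -, h'⟩ := hf
    rw [← h', map_zero]
  have h7 : ∑ j, X j * df (ε j) = df X := by
    obtain ⟨D', -, h'⟩ := hf
    simp only [← h', ← smul_eq_mul, ← map_smul, ← map_sum, Coord.sum_single]
  simp only [berwaldDeriv, h2, h3, d.berwaldCoeff_eq hL hq (hD' _), d.connCoeff_eq hL hq, h5, h6]
  simp only [PiLp.add_apply, PiLp.smul_apply, smul_eq_mul, zero_mul, zero_add]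
  rw [← h7, Finset.sum_mul]
  refine Finset.sum_congr rfl fun j _ => ?_
  have h8 := congrArg (· i) (d.dvert_add_dconn hq hD0 (ε j) (f q.1))
  simp only [PiLp.add_apply, PiLp.smul_apply, smul_eq_mul, PiLp.zero_apply, ← h4] at h8
  have h9 : ∑ k, d.conn q (ε j) k * (f q.1 * d.dvert q (0, ε k) i) =
      f q.1 * ∑ k, d.conn q (ε j) k * d.dvert q (0, ε k) i := by
    rw [Finset.mul_sum]
    exact Finset.sum_congr rfl fun k _ => by ring
  rw [h9]
  linear_combination X j * h8

end KillingData
end Finsler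
end

/-! ### Chart centres, extension of tangent vectors, derivatives of functions. -/

noncomputable section
namespace Finsler

section ChartCenter

variable {n : ℕ} {M : Type*} [TopologicalSpace M] [ChartedSpace (Coord n) M]

/-- The derivative of the inverse of the chart `φ` around `x₀`, in components. -/
def chartDeriv (x₀ : M) (u y : Coord n) : TangentSpace (𝓡 n) ((chartAt (Coord n) x₀).symm u) :=
  mfderiv (𝓡 n) (𝓡 n) (chartAt (Coord n) x₀).symm u (ofCoord u y)

theorem mfderiv_chart_chartDeriv [IsManifold (𝓡 n) 1 M] (x₀ : M) {u : Coord n}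
    (hu : u ∈ (chartAt (Coord n) x₀).target) (y : Coord n) :
    toCoord u (mfderiv (𝓡 n) (𝓡 n) (chartAt (Coord n) x₀) ((chartAt (Coord n) x₀).symm u)
      (chartDeriv x₀ u y)) = y := by
  have h := (mdifferentiable_chart (I := 𝓡 n) x₀).comp_symm_deriv hu
  exact DFunLike.congr_fun h y

theorem toCoord_chartDeriv_center [IsManifold (𝓡 n) 1 M] (x : M) (y : Coord n) :
    toCoord _ (chartDeriv x (chartAt (Coord n) x x) y) = y := by
  -- The base point φ⁻¹(φ x) occurs inside the type of the tangent vector. Since `g` takes plain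
  -- coordinate vectors, that point can be rewritten to x. The same device serves `metric_center`,
  -- `rot_center`, `randers_center` and `vert_center`.
  obtain ⟨g, hg⟩ : ∃ g : M → Coord n → Coord n, ∀ x' w, g x' w = toCoord (chartAt (Coord n) x x')
    (mfderiv (𝓡 n) (𝓡 n) (chartAt (Coord n) x) x' (ofCoord x' w)) := ⟨_, fun _ _ => rfl⟩
  have h1 : ∀ w, g x w = w := by
    intro w
    rw [hg, mfderiv_chartAt_eq_tangentCoordChange (mem_chart_source _ x)]
    exact tangentCoordChange_self (I := 𝓡 n) (mem_extChartAt_source x)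
  have h2 := mfderiv_chart_chartDeriv x (mem_chart_target _ x) y
  have h3 : g ((chartAt (Coord n) x).symm (chartAt (Coord n) x x))
      (toCoord _ (chartDeriv x (chartAt (Coord n) x x) y)) = y := by
    rw [hg]
    exact h2
  rwa [OpenPartialHomeomorph.left_inv _ (mem_chart_source _ x), h1] at h3

end ChartCenter

section Extension

variable {n : ℕ} {M : Type*} [TopologicalSpace M] [ChartedSpace (Coord n) M]
  [IsManifold (𝓡 n) ∞ M] [T2Space M]

/-- A local extension is cut off by a bump function. It lets curvature fields at one point come from
global vector fields. -/
theorem exists_isSmoothField (x : M) (w : TangentSpace (𝓡 n) x) :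
    ∃ X : ∀ x : M, TangentSpace (𝓡 n) x, IsSmoothField X ∧ X x = w := by
  have : IsManifold (𝓡 n) (∞ + 1) M := ‹IsManifold (𝓡 n) ∞ M›
  have : ContMDiffVectorBundle ∞ (Coord n) (TangentSpace (𝓡 n) : M → Type) (𝓡 n) :=
    TangentBundle.contMDiffVectorBundle
  obtain ⟨s, hs, hsm⟩ := FiberBundle.exists_contMDiffOn_extend (k := ∞) (𝓡 n) (Coord n) w
  obtain ⟨b, -, hb⟩ := (SmoothBumpFunction.nhds_basis_tsupport (I := 𝓡 n) x).mem_iff.1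
    (interior_mem_nhds.2 hs)
  refine ⟨fun x' => b x' • FiberBundle.extend (Coord n) w x', ?_, by simp⟩
  exact ContMDiffOn.smul_section_of_tsupport b.contMDiff.contMDiffOn isOpen_interior hb
    (hsm.mono interior_subset)

omit [T2Space M] in
theorem contMDiff_mfderiv_apply {f : M → ℝ} (hf : ContMDiff (𝓡 n) 𝓘(ℝ, ℝ) ∞ f)
    {X : ∀ x : M, TangentSpace (𝓡 n) x} (hX : IsSmoothField X) :
    ContMDiff (𝓡 n) 𝓘(ℝ, ℝ) ∞ (fun x => mvfderiv (𝓡 n) f x (X x)) := by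
  have h1 := hf.contMDiff_tangentMap (m := ∞) (by simp)
  exact (contMDiff_snd_tangentBundle_modelSpace ℝ 𝓘(ℝ, ℝ)).comp (h1.comp hX)

omit [IsManifold (𝓡 n) ∞ M] [T2Space M] in
theorem hasDirDeriv_comp_chart_symm {f : M → ℝ} (hf : ContMDiff (𝓡 n) 𝓘(ℝ, ℝ) ∞ f) (x : M) :
    HasDirDeriv (fun u => f ((chartAt (Coord n) x).symm u)) (chartAt (Coord n) x x)
      (fun v => mvfderiv (𝓡 n) f x (ofCoord x v)) := by
  have h1 : MDifferentiableAt (𝓡 n) 𝓘(ℝ, ℝ) f x := (hf x).mdifferentiableAt (by simp)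
  have h2 := h1.hasMFDerivAt.2
  simp only [writtenInExtChartAt, mfld_simps] at h2
  exact ⟨_, h2.hasFDerivAt Filter.univ_mem, fun v => rfl⟩

end Extension

end Finsler
end

/-! ### Globalization to manifolds and the comparison of the two algebras. -/

noncomputable section
namespace Finsler

/-- A metric, a vector field `v`, a rotation of the tangent spaces and a number `ε` on a manifold
which in the charts are given by `KillingData` with `W = -ε v`. -/
structure NavigationData (n : ℕ) (M : Type*) [TopologicalSpace M] [ChartedSpace (Coord n) M]
    [IsManifold (𝓡 n) 1 M] (K : ℝ) where
  metric : ∀ x : M, TangentSpace (𝓡 n) x → TangentSpace (𝓡 n) x → ℝ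
  field : ∀ x : M, TangentSpace (𝓡 n) x
  rot : ∀ x : M, TangentSpace (𝓡 n) x → TangentSpace (𝓡 n) x
  eps : ℝ
  loc : M → KillingData n K
  metric_smul_left : ∀ (x : M) (c : ℝ) (y z : TangentSpace (𝓡 n) x), metric x (c • y) z = c * metric x y z
  metric_symm : ∀ (x : M) (y z : TangentSpace (𝓡 n) x), metric x y z = metric x z y
  rot_smul : ∀ (x : M) (c : ℝ) (y : TangentSpace (𝓡 n) x), rot x (c • y) = c • rot x y
  mem_U : ∀ x, chartAt (Coord n) x x ∈ (loc x).U
  U_subset : ∀ x, (loc x).U ⊆ (chartAt (Coord n) x).target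
  metric_chart : ∀ x, ∀ u ∈ (loc x).U, ∀ y z, (loc x).h u y z =
    metric ((chartAt (Coord n) x).symm u) (chartDeriv x u y) (chartDeriv x u z)
  field_chart : ∀ x, ∀ u ∈ (loc x).U, chartDeriv x u ((loc x).W u) =
    (-eps) • field ((chartAt (Coord n) x).symm u)
  rot_chart : ∀ x, ∀ u ∈ (loc x).U, ∀ y, chartDeriv x u ((loc x).J u y) =
    rot ((chartAt (Coord n) x).symm u) (chartDeriv x u y)
  -- Up to the factor K, this function is the coefficient of `vert` in the curvature field of X and
  -- Y; its smoothness allows ∇ to be applied repeatedly.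
  contMDiff_area : ∀ X Y : ∀ x : M, TangentSpace (𝓡 n) x, IsSmoothField X → IsSmoothField Y →
    ContMDiff (𝓡 n) 𝓘(ℝ, ℝ) ∞ (fun x => metric x (rot x (X x)) (Y x))

namespace NavigationData

variable {n : ℕ} {M : Type*} [TopologicalSpace M] [ChartedSpace (Coord n) M]
  [IsManifold (𝓡 n) 1 M] {K : ℝ} (D : NavigationData n M K)

/-- The Randers function of the navigation data. -/
def randers : ∀ x : M, TangentSpace (𝓡 n) x → ℝ := shenRanders D.metric D.field D.eps

/-- The square root in the Randers function. -/
def root (x : M) (y : TangentSpace (𝓡 n) x) : ℝ :=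
  √(D.eps ^ 2 * D.metric x (D.field x) y ^ 2 +
    D.metric x y y * (1 - D.eps ^ 2 * D.metric x (D.field x) (D.field x)))

/-- The vertical field spanning the curvature algebras. -/
def vert (x : M) (y : TangentSpace (𝓡 n) x) : TangentSpace (𝓡 n) x :=
  (D.randers x y / D.root x y) • D.rot x (y + (D.eps * D.randers x y) • D.field x)

theorem metric_smul_right (x : M) (c : ℝ) (y z : TangentSpace (𝓡 n) x) :
    D.metric x y (c • z) = c * D.metric x y z := by
  rw [D.metric_symm, D.metric_smul_left, D.metric_symm]

theorem randers_eq (x : M) (y : TangentSpace (𝓡 n) x) :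
    D.randers x y = (D.root x y + D.eps * D.metric x (D.field x) y) /
      (1 - D.eps ^ 2 * D.metric x (D.field x) (D.field x)) := by
  rw [randers, shenRanders, root, add_div]

theorem root_smul (x : M) {t : ℝ} (ht : 0 ≤ t) (y : TangentSpace (𝓡 n) x) :
    D.root x (t • y) = t * D.root x y := by
  nth_rw 2 [← Real.sqrt_sq ht]
  rw [root, root, ← Real.sqrt_mul (sq_nonneg t)]
  simp only [D.metric_smul_left, D.metric_smul_right]
  ring_nf

theorem randers_smul (x : M) {t : ℝ} (ht : 0 ≤ t) (y : TangentSpace (𝓡 n) x) :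
    D.randers x (t • y) = t * D.randers x y := by
  simp only [D.randers_eq, D.root_smul x ht, D.metric_smul_right]
  ring

/-- Degree-one homogeneity makes `vert` coincide with the homogeneous extension of its restriction
to the indicatrix. -/
theorem vert_smul (x : M) {t : ℝ} (ht : 0 < t) (y : TangentSpace (𝓡 n) x) :
    D.vert x (t • y) = t • D.vert x y := by
  have h : t • y + (D.eps * (t * D.randers x y)) • D.field x =
      t • (y + (D.eps * D.randers x y) • D.field x) := by module
  rw [vert, D.randers_smul x ht.le, D.root_smul x ht.le, h, D.rot_smul, vert,
    mul_div_mul_left _ _ ht.ne', smul_comm]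

omit [IsManifold (𝓡 n) 1 M] in
theorem chartDeriv_add (x : M) (u y z : Coord n) :
    chartDeriv x u (y + z) = chartDeriv x u y + chartDeriv x u z :=
  map_add (mfderiv (𝓡 n) (𝓡 n) (chartAt (Coord n) x).symm u) y z

omit [IsManifold (𝓡 n) 1 M] in
theorem chartDeriv_smul (x : M) (u : Coord n) (c : ℝ) (y : Coord n) :
    chartDeriv x u (c • y) = c • chartDeriv x u y :=
  map_smul (mfderiv (𝓡 n) (𝓡 n) (chartAt (Coord n) x).symm u) c y

section Chart

variable (x : M) {u : Coord n} (hu : u ∈ (D.loc x).U) (y : Coord n)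
include hu

theorem h_W_left : (D.loc x).h u ((D.loc x).W u) y =
    -D.eps * D.metric ((chartAt (Coord n) x).symm u) (D.field _) (chartDeriv x u y) := by
  rw [D.metric_chart x u hu, D.field_chart x u hu, D.metric_smul_left]

theorem κ_chart : (D.loc x).κ u =
    1 - D.eps ^ 2 * D.metric ((chartAt (Coord n) x).symm u) (D.field _) (D.field _) := by
  rw [KillingData.κ, D.h_W_left x hu, D.field_chart x u hu, D.metric_smul_right]
  ring

theorem μ_chart : (D.loc x).μ (u, y) = D.root _ (chartDeriv x u y) := by
  simp only [KillingData.μ, root, D.κ_chart x hu, D.h_W_left x hu, D.metric_chart x u hu y y]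
  congr 2
  ring

theorem F_chart : (D.loc x).F (u, y) = D.randers _ (chartDeriv x u y) := by
  rw [D.randers_eq, KillingData.F, D.μ_chart x hu, D.κ_chart x hu, D.h_W_left x hu]
  ring

theorem vert_chart : chartDeriv x u ((D.loc x).vert (u, y)) = D.vert _ (chartDeriv x u y) := by
  have : chartDeriv x u ((D.loc x).N (u, y)) = chartDeriv x u y +
      (D.eps * D.randers _ (chartDeriv x u y)) • D.field ((chartAt (Coord n) x).symm u) := by
    have h1 : (D.loc x).N (u, y) = y + (-(D.loc x).F (u, y)) • (D.loc x).W u := by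
      simp only [KillingData.N]
      module
    rw [h1, chartDeriv_add, chartDeriv_smul, D.field_chart x u hu, D.F_chart x hu, smul_smul]
    congr 2
    ring
  rw [KillingData.vert, chartDeriv_smul, D.rot_chart x u hu, this, vert, D.F_chart x hu,
    D.μ_chart x hu]

end Chart

theorem inChart_eq (x : M) : ∀ q ∈ (D.loc x).dom, inChart D.randers x q.1 q.2 = (D.loc x).F q :=
  fun q hq => (D.F_chart x hq.1 q.2).symm

section Center

variable (x : M)

theorem metric_center (y z : TangentSpace (𝓡 n) x) : D.metric x y z =
    (D.loc x).h (chartAt (Coord n) x x) (toCoord x y) (toCoord x z) := by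
  obtain ⟨g, hg⟩ : ∃ g : M → Coord n → Coord n → ℝ,
    ∀ x' y z, g x' y z = D.metric x' (ofCoord x' y) (ofCoord x' z) := ⟨_, fun _ _ _ => rfl⟩
  rw [D.metric_chart x _ (D.mem_U x)]
  refine Eq.trans ?_ (hg ((chartAt (Coord n) x).symm (chartAt (Coord n) x x))
    (toCoord _ (chartDeriv x (chartAt (Coord n) x x) (toCoord x y)))
    (toCoord _ (chartDeriv x (chartAt (Coord n) x x) (toCoord x z))))
  rw [toCoord_chartDeriv_center, toCoord_chartDeriv_center,
    OpenPartialHomeomorph.left_inv _ (mem_chart_source _ x), hg]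
  rfl

theorem rot_center (y : TangentSpace (𝓡 n) x) : toCoord x (D.rot x y) =
    (D.loc x).J (chartAt (Coord n) x x) (toCoord x y) := by
  obtain ⟨g, hg⟩ : ∃ g : M → Coord n → Coord n,
    ∀ x' y, g x' y = toCoord x' (D.rot x' (ofCoord x' y)) := ⟨_, fun _ _ => rfl⟩
  have h1 := hg ((chartAt (Coord n) x).symm (chartAt (Coord n) x x))
    (toCoord _ (chartDeriv x (chartAt (Coord n) x x) (toCoord x y)))
  have h2 : toCoord _ (chartDeriv x (chartAt (Coord n) x x)
      ((D.loc x).J (chartAt (Coord n) x x) (toCoord x y))) = g _ _ :=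
    (congrArg (toCoord _) (D.rot_chart x _ (D.mem_U x) (toCoord x y))).trans h1.symm
  rw [toCoord_chartDeriv_center, toCoord_chartDeriv_center,
    OpenPartialHomeomorph.left_inv _ (mem_chart_source _ x), hg] at h2
  exact h2.symm

theorem randers_center (y : TangentSpace (𝓡 n) x) : D.randers x y =
    (D.loc x).F (chartAt (Coord n) x x, toCoord x y) := by
  obtain ⟨g, hg⟩ : ∃ g : M → Coord n → ℝ,
    ∀ x' y, g x' y = D.randers x' (ofCoord x' y) := ⟨_, fun _ _ => rfl⟩
  rw [D.F_chart x (D.mem_U x)]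
  refine Eq.trans ?_ (hg ((chartAt (Coord n) x).symm (chartAt (Coord n) x x))
    (toCoord _ (chartDeriv x (chartAt (Coord n) x x) (toCoord x y))))
  rw [toCoord_chartDeriv_center, OpenPartialHomeomorph.left_inv _ (mem_chart_source _ x), hg]
  rfl

theorem vert_center (y : TangentSpace (𝓡 n) x) : toCoord x (D.vert x y) =
    (D.loc x).vert (chartAt (Coord n) x x, toCoord x y) := by
  obtain ⟨g, hg⟩ : ∃ g : M → Coord n → Coord n,
    ∀ x' y, g x' y = toCoord x' (D.vert x' (ofCoord x' y)) := ⟨_, fun _ _ => rfl⟩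
  have h1 := hg ((chartAt (Coord n) x).symm (chartAt (Coord n) x x))
    (toCoord _ (chartDeriv x (chartAt (Coord n) x x) (toCoord x y)))
  have h2 : toCoord _ (chartDeriv x (chartAt (Coord n) x x)
      ((D.loc x).vert (chartAt (Coord n) x x, toCoord x y))) = g _ _ :=
    (congrArg (toCoord _) (D.vert_chart x (D.mem_U x) (toCoord x y))).trans h1.symm
  rw [toCoord_chartDeriv_center, toCoord_chartDeriv_center,
    OpenPartialHomeomorph.left_inv _ (mem_chart_source _ x), hg] at h2
  exact h2.symm

variable {x} in
theorem mem_dom {y : TangentSpace (𝓡 n) x} (hy : y ≠ 0) :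
    (chartAt (Coord n) x x, toCoord x y) ∈ (D.loc x).dom :=
  ⟨D.mem_U x, hy⟩

end Center

theorem randers_pos (x : M) (y : TangentSpace (𝓡 n) x) (hy : y ≠ 0) : 0 < D.randers x y := by
  rw [D.randers_center]
  exact (D.loc x).F_pos (D.mem_dom hy)

theorem posDef (x : M) (y w : TangentSpace (𝓡 n) x) (hy : y ≠ 0) (hw : w ≠ 0) :
    0 < ∑ i, ∑ j, fundTensor (inChart D.randers x) i j (chartAt (Coord n) x x) (toCoord x y)
      * toCoord x w i * toCoord x w j := by
  rw [(D.loc x).sum_sum_fundTensor_eq (D.inChart_eq x) (D.mem_dom hy)]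
  exact (D.loc x).gt_pos (D.mem_dom hy) hw

theorem hasConstantFlagCurvature : HasConstantFlagCurvature D.randers K := by
  intro x y hy i j k
  rw [(D.loc x).curvCoeff_eq (D.inChart_eq x) (D.mem_dom hy),
    (D.loc x).sum_fundTensor_eq (D.inChart_eq x) (D.mem_dom hy),
    (D.loc x).sum_fundTensor_eq (D.inChart_eq x) (D.mem_dom hy)]
  simp only [PiLp.single_apply]
  ring

theorem ne_zero_of_mem_indicatrix {x : M} (y : Indicatrix D.randers x) : y.1 ≠ 0 := by
  intro h
  have h1 := y.2
  have h2 := D.randers_smul x le_rfl y.1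
  rw [zero_smul, zero_mul] at h2
  rw [h, h2] at h1
  exact zero_ne_one h1

/-- The restriction of `f • vert` to the indicatrix bundle. -/
def vertField (f : M → ℝ) : BundleField D.randers := fun x y => f x • D.vert x y.1

theorem homExt_vertField (f : M → ℝ) (x : M) {y : TangentSpace (𝓡 n) x} (hy : y ≠ 0) :
    homExt D.randers x (D.vertField f x) y = f x • D.vert x y := by
  have h0 := D.randers_pos x y hy
  have h1 : D.randers x ((D.randers x y)⁻¹ • y) = 1 := by
    rw [D.randers_smul x (inv_pos.2 h0).le, inv_mul_cancel₀ h0.ne']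
  rw [homExt, dif_pos h1, vertField, D.vert_smul x (inv_pos.2 h0), smul_comm (f x), smul_smul,
    mul_inv_cancel₀ h0.ne', one_smul]

theorem homExt_vertField_zero (f : M → ℝ) (x : M) :
    homExt D.randers x (D.vertField f x) 0 = 0 := by
  have h2 := D.randers_smul x le_rfl 0
  rw [zero_smul, zero_mul] at h2
  rw [homExt, dif_neg]
  simp [h2]

/-- The `wedge` identity applied to N, X, Y: in dimension two all curvature fields at a point are
proportional to one field. -/
theorem _root_.Finsler.KillingData.p_smul_sub {n : ℕ} {K : ℝ} (d : KillingData n K)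
    {q : Coord n × Coord n} (hq : q ∈ d.dom) (X Y : Coord n) :
    d.F q • (d.p q X • Y - d.p q Y • X) = d.h q.1 (d.J q.1 X) Y • d.vert q := by
  have h1 := d.wedge q.1 hq.1 (d.N q) X Y
  rw [KillingData.vert, smul_comm, ← h1, ← d.μ_mul_p hq, ← d.μ_mul_p hq, div_eq_inv_mul, mul_smul,
    smul_comm]
  simp only [mul_smul, ← smul_sub]
  rw [inv_smul_smul₀ (d.μ_pos hq).ne']

theorem _root_.Finsler.sum_alternating {n : ℕ} (c : ℝ) (p X Y : Fin n → ℝ)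
    (e : Fin n → ℝ) :
    ∑ j, ∑ k, c * (p j * e k - p k * e j) * X j * Y k =
      c * ((∑ j, X j * p j) * ∑ k, Y k * e k - (∑ k, Y k * p k) * ∑ j, X j * e j) := by
  rw [Finset.sum_mul_sum, Finset.sum_mul_sum,
    Finset.sum_comm (f := fun i j => Y i * p i * (X j * e j)), ← Finset.sum_sub_distrib,
    Finset.mul_sum]
  refine Finset.sum_congr rfl fun j _ => ?_
  rw [← Finset.sum_sub_distrib, Finset.mul_sum]
  exact Finset.sum_congr rfl fun k _ => by ring

theorem curvFieldAt_eq (x : M) (X Y : TangentSpace (𝓡 n) x) :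
    curvFieldAt D.randers x X Y =
      fun y => (K * D.metric x (D.rot x X) Y) • D.vert x y.1 := by
  ext1 y
  have hy := D.mem_dom (D.ne_zero_of_mem_indicatrix y)
  have h1 : (K * D.metric x (D.rot x X) Y) • D.vert x y.1 = ofCoord x (K • ((D.loc x).F (chartAt (Coord n) x x, toCoord x y.1) •
      ((D.loc x).p (chartAt (Coord n) x x, toCoord x y.1) (toCoord x X) • toCoord x Y -
        (D.loc x).p (chartAt (Coord n) x x, toCoord x y.1) (toCoord x Y) • toCoord x X))) := by
    rw [(D.loc x).p_smul_sub hy, smul_smul, ← D.vert_center, ← D.rot_center, ← D.metric_center]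
    rfl
  rw [h1]
  refine congrArg (ofCoord x) ?_
  ext i
  have h2 : ∀ X : Coord n, ∑ j, X j * (EuclideanSpace.single j (1 : ℝ) : Coord n) i = X i := by
    intro X
    simp
  simp only [(D.loc x).curvCoeff_eq (D.inChart_eq x) hy, PiLp.smul_apply, PiLp.sub_apply,
    smul_eq_mul, ← (D.loc x).p_sum _ (toCoord x X), ← (D.loc x).p_sum _ (toCoord x Y), ← mul_assoc]
  rw [sum_alternating, h2, h2]

theorem fieldInChart_vertField (f : M → ℝ) (x : M) : ∀ q ∈ (D.loc x).dom,
    fieldInChart D.randers (D.vertField f) x q.1 q.2 =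
      f ((chartAt (Coord n) x).symm q.1) • (D.loc x).vert q := by
  intro q hq
  have hu := D.U_subset x hq.1
  have h0 : chartDeriv x q.1 q.2 ≠ 0 := by
    intro h
    have h1 := mfderiv_chart_chartDeriv x hu q.2
    rw [h] at h1
    exact hq.2 (h1.symm.trans (map_zero _))
  have h2 : homExt D.randers _ (D.vertField f _) (chartDeriv x q.1 q.2) =
      chartDeriv x q.1 (f ((chartAt (Coord n) x).symm q.1) • (D.loc x).vert q) := by
    rw [D.homExt_vertField f _ h0, chartDeriv_smul, D.vert_chart x hq.1]
  rw [← mfderiv_chart_chartDeriv x hu (f ((chartAt (Coord n) x).symm q.1) • (D.loc x).vert q), ← h2]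
  rfl

theorem nabla_vertField [IsManifold (𝓡 n) ∞ M] {f : M → ℝ} (hf : ContMDiff (𝓡 n) 𝓘(ℝ, ℝ) ∞ f)
    (X : ∀ x : M, TangentSpace (𝓡 n) x) :
    nabla D.randers X (D.vertField f) = D.vertField (fun x => mvfderiv (𝓡 n) f x (X x)) := by
  ext1 x
  ext1 y
  have hy := D.mem_dom (D.ne_zero_of_mem_indicatrix y)
  have h1 := (D.loc x).berwaldDeriv_eq (D.inChart_eq x) hy (toCoord x (X x))
    (hasDirDeriv_comp_chart_symm hf x) (D.fieldInChart_vertField f x)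
  rw [← D.vert_center] at h1
  exact congrArg (ofCoord x) h1

/-- Both sides also vanish at y = 0, so the equality holds on the whole tangent space and can be
substituted inside brackets. -/
theorem homExt_vertField_eq_smul (f : M → ℝ) (x : M) (y : TangentSpace (𝓡 n) x) :
    homExt D.randers x (D.vertField f x) y = f x • D.vert x y := by
  by_cases hy : y = 0
  · rw [hy, D.homExt_vertField_zero, vert, D.randers_eq]
    have h2 := D.root_smul x le_rfl 0
    rw [zero_smul, zero_mul] at h2
    simp [h2]
  · exact D.homExt_vertField f x hy

/-- On one fibre f and g are constants, so both fields are multiples of the same field. Constants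
leave `fderiv` without any differentiability assumption. -/
theorem fibreBracket_vertField (f g : M → ℝ) (x : M) :
    fibreBracket D.randers x (D.vertField f x) (D.vertField g x) = 0 := by
  ext1 y
  obtain ⟨V, hV⟩ : ∃ V : Coord n → Coord n, ∀ z, V z = toCoord x (D.vert x (ofCoord x z)) :=
    ⟨_, fun _ => rfl⟩
  have h1 : ∀ f : M → ℝ, (fun z => toCoord x (homExt D.randers x (D.vertField f x) (ofCoord x z))) =
      f x • V := by
    intro f
    ext1 z
    rw [D.homExt_vertField_eq_smul, Pi.smul_apply, hV]
    rfl
  rw [fibreBracket, h1, h1, VectorField.lieBracket]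
  simp only [fderiv_const_smul_field, Pi.smul_apply, smul_apply, map_smul]
  rw [smul_comm, sub_self]
  rfl

/-- The fields `f • vert` with smooth `f`. -/
def smoothVert : Submodule ℝ (BundleField D.randers) where
  carrier := {ξ | ∃ f : M → ℝ, ContMDiff (𝓡 n) 𝓘(ℝ, ℝ) ∞ f ∧ ξ = D.vertField f}
  zero_mem' := ⟨fun _ => 0, contMDiff_const, by
    ext x y
    simp [vertField]⟩
  add_mem' := by
    rintro _ _ ⟨f, hf, rfl⟩ ⟨g, hg, rfl⟩
    refine ⟨fun x => f x + g x, hf.add hg, ?_⟩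
    ext1 x
    ext1 y
    exact (add_smul _ _ _).symm
  smul_mem' := by
    rintro c _ ⟨f, hf, rfl⟩
    refine ⟨fun x => c * f x, contMDiff_const.mul hf, ?_⟩
    ext1 x
    ext1 y
    exact smul_smul c (f x) (D.vert x y.1)

theorem holonomyAlgebra_le [IsManifold (𝓡 n) ∞ M] : holonomyAlgebra D.randers ≤ D.smoothVert := by
  refine sInf_le ⟨fun X Y hX hY => ?_, ?_, ?_⟩
  · refine ⟨fun x => K * D.metric x (D.rot x (X x)) (Y x),
      contMDiff_const.mul (D.contMDiff_area X Y hX hY), ?_⟩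
    ext1 x
    exact D.curvFieldAt_eq x (X x) (Y x)
  · rintro _ ⟨f, hf, rfl⟩ _ ⟨g, hg, rfl⟩
    have : bracket D.randers (D.vertField f) (D.vertField g) = 0 := by
      ext1 x
      exact D.fibreBracket_vertField f g x
    rw [this]
    exact zero_mem _
  · rintro _ ⟨f, hf, rfl⟩ X hX
    rw [D.nabla_vertField hf]
    exact ⟨_, contMDiff_mfderiv_apply hf hX, rfl⟩

theorem exists_rot_ne_zero [Nontrivial (Coord n)] (hK : K ≠ 0) (x : M) :
    ∃ X Y : TangentSpace (𝓡 n) x, K * D.metric x (D.rot x X) Y ≠ 0 := by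
  obtain ⟨w, hw⟩ := exists_ne (0 : Coord n)
  -- With Y = JX the area is h(JX, JX) = h(X, X) > 0.
  refine ⟨ofCoord x w, D.rot x (ofCoord x w), mul_ne_zero hK ?_⟩
  rw [D.metric_center, D.rot_center, (D.loc x).J_skew _ (D.mem_U x), (D.loc x).J_sq _ (D.mem_U x),
    map_neg, neg_neg]
  exact ((D.loc x).h_pos _ (D.mem_U x) w hw).ne'

/-- One inclusion rescales a nonzero curvature field to reach any multiple of `vert`. The other
extends tangent vectors to global fields and uses that brackets are computed fibrewise. -/
theorem holonomyAlgebraAt_eq [IsManifold (𝓡 n) ∞ M] [T2Space M] [Nontrivial (Coord n)] (hK : K ≠ 0)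
    (x : M) : holonomyAlgebraAt D.randers x = curvatureAlgebraAt D.randers x := by
  apply le_antisymm
  · rintro _ ⟨ξ, hξ, rfl⟩
    obtain ⟨f, -, rfl⟩ := D.holonomyAlgebra_le hξ
    rw [curvatureAlgebraAt, Submodule.mem_sInf]
    rintro S ⟨hS, -⟩
    obtain ⟨X, Y, hXY⟩ := D.exists_rot_ne_zero hK x
    have h1 := S.smul_mem (f x * (K * D.metric x (D.rot x X) Y)⁻¹) (hS X Y)
    convert h1 using 1
    ext1 y
    rw [D.curvFieldAt_eq, Pi.smul_apply, smul_smul, inv_mul_cancel_right₀ hXY]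
    rfl
  · refine sInf_le ⟨fun X Y => ?_, ?_⟩
    · obtain ⟨X', hX', hX⟩ := exists_isSmoothField x X
      obtain ⟨Y', hY', hY⟩ := exists_isSmoothField x Y
      refine ⟨curvField D.randers X' Y', ?_, ?_⟩
      · exact Submodule.mem_sInf.2 fun S hS => hS.1 X' Y' hX' hY'
      · rw [← hX, ← hY]
        rfl
    · rintro _ ⟨ξ, hξ, rfl⟩ _ ⟨η, hη, rfl⟩
      refine ⟨bracket D.randers ξ η, ?_, rfl⟩
      exact Submodule.mem_sInf.2 fun S hS =>
        hS.2.1 ξ (Submodule.mem_sInf.1 hξ S hS) η (Submodule.mem_sInf.1 hη S hS)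

end NavigationData
end Finsler
end

noncomputable section
namespace Finsler

theorem HasDirDeriv.inner {E V : Type*} [NormedAddCommGroup E] [NormedSpace ℝ E]
    [NormedAddCommGroup V] [InnerProductSpace ℝ V] {f g d e : E → V} {q : E}
    (hf : HasDirDeriv f q d) (hg : HasDirDeriv g q e) :
    HasDirDeriv (fun z => ⟪f z, g z⟫) q (fun v => ⟪d v, g q⟫ + ⟪f q, e v⟫) := by
  obtain ⟨D, hD, hd⟩ := hf
  obtain ⟨D', hD', hd'⟩ := hg
  refine ⟨_, hD.inner ℝ hD', fun v => ?_⟩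
  simp [hd, hd', add_comm]

theorem HasDirDeriv.sqrt {E : Type*} [NormedAddCommGroup E] [NormedSpace ℝ E]
    {f d : E → ℝ} {q : E} (hf : HasDirDeriv f q d) (h0 : f q ≠ 0) :
    HasDirDeriv (fun z => √(f z)) q (fun v => d v / (2 * √(f q))) := by
  obtain ⟨D, hD, hd⟩ := hf
  refine ⟨_, hD.sqrt h0, fun v => ?_⟩
  simp [hd]
  ring

/-! ### Rotations of the plane -/

/-- A rotation of `ℝ²` by a right angle. -/
structure IsRightRotation (j : Coord 2 →L[ℝ] Coord 2) : Prop where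
  skew : ∀ X Y, ⟪j X, Y⟫ = - ⟪X, j Y⟫
  sq : ∀ X, j (j X) = -X

namespace IsRightRotation

variable {j : Coord 2 →L[ℝ] Coord 2} (hj : IsRightRotation j)
include hj

theorem inner_self (X : Coord 2) : ⟪X, j X⟫ = 0 := by
  have := hj.skew X X
  rw [real_inner_comm] at this
  linarith

theorem inner_map (X Y : Coord 2) : ⟪j X, j Y⟫ = ⟪X, Y⟫ := by
  rw [hj.skew, hj.sq, inner_neg_right, neg_neg]

theorem wedge (X Y Z : Coord 2) : ⟪X, Y⟫ • Z - ⟪X, Z⟫ • Y = ⟪j Y, Z⟫ • j X := by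
  -- Skewness leaves a single free matrix entry t; `hj.sq` then forces t² = 1.
  obtain ⟨t, ht⟩ : ∃ t, ∀ X, j X = !₂[-t * X 1, t * X 0] := by
    have e0 := hj.inner_self (EuclideanSpace.single 0 1)
    have e1 := hj.inner_self (EuclideanSpace.single 1 1)
    have e2 := hj.skew (EuclideanSpace.single 0 1) (EuclideanSpace.single 1 1)
    simp [PiLp.inner_apply] at e0 e1 e2
    refine ⟨j (EuclideanSpace.single 0 1) 1, fun X => ?_⟩
    nth_rw 1 [← Coord.sum_single X]
    rw [Fin.sum_univ_two, map_add, map_smul, map_smul]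
    ext i
    fin_cases i <;> simp [e0, e1, e2] <;> ring
  have h1 := congrArg (· 0) (hj.sq (EuclideanSpace.single 0 1))
  simp [ht] at h1
  ext i
  fin_cases i <;> simp [ht, PiLp.inner_apply, Fin.sum_univ_two]
  · linear_combination (Z 1 * Y 0 * X 1 - Y 1 * Z 0 * X 1) * h1
  · linear_combination (Z 0 * Y 1 * X 0 - Y 0 * Z 1 * X 0) * h1

end IsRightRotation

/-! ### The round metric in stereographic coordinates -/

section Forms

variable {E : Type*} [NormedAddCommGroup E] [InnerProductSpace ℝ E]

/-- The scalar product as a bilinear form. -/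
def dot : E →L[ℝ] E →L[ℝ] ℝ := innerSL ℝ

theorem dot_apply (X Y : E) : dot X Y = ⟪X, Y⟫ := rfl

/-- `⟨u, y⟩ z`, as a form in `y` and `z` depending linearly on `u`. -/
def leftForm : E →L[ℝ] E →L[ℝ] E →L[ℝ] E :=
  (ContinuousLinearMap.smulRightL ℝ E (E →L[ℝ] E)).flip (ContinuousLinearMap.id ℝ E) ∘L dot

theorem leftForm_apply (u y z : E) : leftForm u y z = ⟪u, y⟫ • z := rfl

/-- `⟨u, z⟩ y`, as a form in `y` and `z` depending linearly on `u`. -/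
def rightForm : E →L[ℝ] E →L[ℝ] E →L[ℝ] E :=
  ContinuousLinearMap.smulRightL ℝ E E ∘L dot

theorem rightForm_apply (u y z : E) : rightForm u y z = ⟪u, z⟫ • y := rfl

/-- `⟨u, y⟩ z + ⟨u, z⟩ y - ⟨y, z⟩ u`, as a form in `y` and `z` depending linearly on `u`. -/
def conformalForm : E →L[ℝ] E →L[ℝ] E →L[ℝ] E :=
  leftForm + rightForm - rightForm.flip

theorem conformalForm_apply (u y z : E) :
    conformalForm u y z = ⟪u, y⟫ • z + ⟪u, z⟫ • y - ⟪y, z⟫ • u := rfl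

theorem hasDirDeriv_conformalForm (u : E) :
    HasDirDeriv (fun u : E => conformalForm u) u (fun u => conformalForm u) :=
  ⟨conformalForm, (conformalForm (E := E)).hasFDerivAt, fun _ => rfl⟩

end Forms

section Sphere

variable (j : Coord 2 →L[ℝ] Coord 2) (c : ℝ) (β : Coord 2)

/-- `1 / (4 + |u|²)`. -/
def stereoFactor (u : Coord 2) : ℝ := (4 + ⟪u, u⟫)⁻¹

theorem stereoFactor_den_pos (u : Coord 2) : 0 < 4 + ⟪u, u⟫ := by
  have := real_inner_self_nonneg (x := u)
  linarith

theorem hasDirDeriv_stereoFactor (u : Coord 2) :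
    HasDirDeriv stereoFactor u (fun X => -2 * ⟪u, X⟫ * stereoFactor u ^ 2) := by
  refine (((HasDirDeriv.const 4).add (HasDirDeriv.id.inner HasDirDeriv.id)).inv
    (stereoFactor_den_pos u).ne').congr_deriv fun X => ?_
  have := (stereoFactor_den_pos u).ne'
  rw [stereoFactor, real_inner_comm u X]
  field_simp
  ring

/-- A Killing field of the round metric in stereographic coordinates. -/
def stereoField (u : Coord 2) : Coord 2 :=
  c • j u + (1 - ⟪u, u⟫ / 4) • β + (⟪u, β⟫ / 2) • u

/-- The round metric with a Killing field in stereographic coordinates. -/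
def stereoData (hj : IsRightRotation j)
    (hW : ∀ u, 16 * stereoFactor u ^ 2 * ⟪stereoField j c β u, stereoField j c β u⟫ < 1) :
    KillingData 2 1 where
  U := Set.univ
  isOpen_U := isOpen_univ
  h u := (16 * stereoFactor u ^ 2) • dot
  -- The Levi-Civita connection of a conformally flat metric; J is then the constant Euclidean
  -- rotation.
  Γ u := (-2 * stereoFactor u) • conformalForm u
  J _ := j
  W := stereoField j c β
  a u := stereoFactor u * (c * (4 - ⟪u, u⟫) - 4 * ⟪j u, β⟫)
  h_symm u X Y := by simp only [smul_apply, dot_apply, real_inner_comm]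
  h_pos u _ X hX := by
    have h1 := inv_pos.2 (stereoFactor_den_pos u)
    have h2 := real_inner_self_pos.2 hX
    simp only [smul_apply, dot_apply, smul_eq_mul, stereoFactor]
    positivity
  Γ_symm u X Y := by
    simp only [smul_apply, conformalForm_apply, real_inner_comm X Y]
    module
  W_lt u _ := hW u
  J_skew u _ X Y := by simp [dot_apply, hj.skew X Y]
  J_sq u _ X := hj.sq X
  wedge u _ X Y Z := by
    simp only [smul_apply, dot_apply, smul_eq_mul, mul_smul, ← smul_sub, hj.wedge]
  deriv_h u _ := by
    refine ⟨_, (((HasDirDeriv.const 16).mul ((hasDirDeriv_stereoFactor u).mul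
      (hasDirDeriv_stereoFactor u))).congr_of_eventuallyEq (.of_forall fun z => by
        simp only [pow_two])).smul (HasDirDeriv.const dot), fun X Y Z => ?_⟩
    simp only [smul_apply, add_apply, dot_apply, smul_eq_mul, conformalForm_apply,
      smul_zero, zero_apply, inner_smul_left, inner_smul_right, inner_add_left, inner_add_right,
      inner_sub_left, inner_sub_right, conj_trivial, real_inner_comm X Y, real_inner_comm u]
    ring
  deriv_W u _ := by
    refine (((HasDirDeriv.const c).smul (HasDirDeriv.clm j)).add (((HasDirDeriv.const 1).sub
      ((HasDirDeriv.id.inner HasDirDeriv.id).div (HasDirDeriv.const 4) (by norm_num))).smul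
      (HasDirDeriv.const β)) |>.add (((HasDirDeriv.id.inner (HasDirDeriv.const β)).div
      (HasDirDeriv.const 2) (by norm_num)).smul HasDirDeriv.id)).congr_deriv fun X => ?_
    -- The remaining relations among u, X and their rotations are two-dimensional, so `wedge` must
    -- supply them before coefficients are compared.
    have w1 := hj.wedge X u β
    have w2 := hj.wedge X u (j u)
    have h1 := (stereoFactor_den_pos u).ne'
    have h2 := hj.inner_self u
    rw [hj.inner_map] at w2
    simp only [smul_apply, conformalForm_apply, stereoField, inner_add_right, inner_smul_right, h2,
      real_inner_comm u X, stereoFactor, inner_zero_right]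
    rw [real_inner_comm u X] at w1 w2
    linear_combination (norm := (match_scalars <;> field_simp <;> ring))
      (-(1 / 2) - 2 * (4 + ⟪u, u⟫)⁻¹ * (1 - ⟪u, u⟫ / 4)) • w1 + (-2 * (4 + ⟪u, u⟫)⁻¹ * c) • w2
  deriv_J u _ := by
    refine ⟨_, HasDirDeriv.const j, fun X Y => ?_⟩
    have w1 := congrArg j (hj.wedge Y u X)
    have w2 := hj.wedge (j Y) u X
    simp only [smul_apply, conformalForm_apply, map_smul, map_add, map_sub, zero_apply, hj.sq,
      real_inner_comm _ Y, real_inner_comm _ (j Y)] at w1 w2 ⊢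
    linear_combination (norm := module) (2 * stereoFactor u) • w1 - (2 * stereoFactor u) • w2
  deriv_a u _ := by
    refine ((hasDirDeriv_stereoFactor u).mul (((HasDirDeriv.const c).mul
      ((HasDirDeriv.const 4).sub (HasDirDeriv.id.inner HasDirDeriv.id))).sub
      ((HasDirDeriv.const 4).mul
        ((HasDirDeriv.clm j).inner (HasDirDeriv.const β))))).congr_deriv fun X => ?_
    have w := congrArg (⟪·, β⟫) (hj.wedge X u (j u))
    have h1 := (stereoFactor_den_pos u).ne'
    have h2 := hj.skew X u
    simp only [hj.inner_map, inner_sub_left, real_inner_smul_left, real_inner_comm u X] at w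
    simp only [smul_apply, dot_apply, smul_eq_mul, stereoField, inner_add_right, inner_smul_right,
      hj.inner_map, real_inner_comm u X, h2, stereoFactor, inner_zero_right]
    field_simp
    linear_combination 64 * w
  deriv_Γ u _ := by
    refine ⟨_, ((HasDirDeriv.const (-2)).mul (hasDirDeriv_stereoFactor u)).smul
      (hasDirDeriv_conformalForm u), fun X Y Z => ?_⟩
    have h1 := (stereoFactor_den_pos u).ne'
    simp only [smul_apply, add_apply, conformalForm_apply, dot_apply, inner_smul_right,
      inner_add_right, inner_sub_right, real_inner_comm X Y, real_inner_comm u, stereoFactor,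
      smul_eq_mul]
    match_scalars <;> field_simp <;> ring

end Sphere

end Finsler
end

noncomputable section
namespace Finsler

/-! ### The Klein metric -/

theorem HasDirDeriv.smulRight {E V V' : Type*} [NormedAddCommGroup E] [NormedSpace ℝ E]
    [NormedAddCommGroup V] [NormedSpace ℝ V] [NormedAddCommGroup V'] [NormedSpace ℝ V']
    {c dc : E → V →L[ℝ] ℝ} {f d : E → V'} {q : E}
    (hc : HasDirDeriv c q dc) (hf : HasDirDeriv f q d) :
    HasDirDeriv (fun z => (c z).smulRight (f z)) q
      (fun v => (dc v).smulRight (f q) + (c q).smulRight (d v)) :=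
  (hc.comp_clm (ContinuousLinearMap.smulRightL ℝ V V')).clm_apply hf

section SquareForm

variable {E : Type*} [NormedAddCommGroup E] [InnerProductSpace ℝ E]

/-- `⟨u, y⟩ ⟨u, z⟩`. -/
def squareForm (u : E) : E →L[ℝ] E →L[ℝ] ℝ := (dot u).smulRight (dot u)

theorem squareForm_apply (u y z : E) : squareForm u y z = ⟪u, y⟫ * ⟪u, z⟫ := rfl

theorem hasDirDeriv_squareForm (u : E) : ∃ D, HasDirDeriv squareForm u D ∧
    ∀ X Y Z, D X Y Z = ⟪X, Y⟫ * ⟪u, Z⟫ + ⟪u, Y⟫ * ⟪X, Z⟫ := by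
  have h1 : HasDirDeriv (fun u : E => dot u) u (fun u => dot u) :=
    ⟨dot, (dot (E := E)).hasFDerivAt, fun _ => rfl⟩
  exact ⟨_, h1.smulRight h1, fun X Y Z => rfl⟩

end SquareForm

section Klein

variable (j : Coord 2 →L[ℝ] Coord 2) (ε : ℝ)

/-- `1 / (1 - |u|²)`. -/
def kleinFactor (u : Coord 2) : ℝ := (1 - ⟪u, u⟫)⁻¹

/-- The rotation by a right angle for the Klein metric. -/
def kleinRot (u : Coord 2) : Coord 2 →L[ℝ] Coord 2 :=
  √(1 - ⟪u, u⟫) • (j ∘L (ContinuousLinearMap.id ℝ (Coord 2) + (kleinFactor u • dot u).smulRight u))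

theorem kleinRot_apply (u X : Coord 2) :
    kleinRot j u X = √(1 - ⟪u, u⟫) • j (X + (kleinFactor u * ⟪u, X⟫) • u) := rfl

theorem inner_mul_lt {u : Coord 2} (hu : u ∈ Metric.ball (0 : Coord 2) (1 / √(1 + ε ^ 2))) :
    ⟪u, u⟫ * (1 + ε ^ 2) < 1 := by
  rw [mem_ball_zero_iff, lt_div_iff₀ (by positivity)] at hu
  rw [real_inner_self_eq_norm_sq]
  have h1 : (‖u‖ * √(1 + ε ^ 2)) ^ 2 < 1 := by
    rw [sq_lt_one_iff_abs_lt_one, abs_of_nonneg (by positivity)]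
    exact hu
  rwa [mul_pow, Real.sq_sqrt (by positivity)] at h1

theorem kleinFactor_den_pos {u : Coord 2} (hu : u ∈ Metric.ball (0 : Coord 2) (1 / √(1 + ε ^ 2))) :
    0 < 1 - ⟪u, u⟫ := by
  have h1 := inner_mul_lt ε hu
  have h2 := real_inner_self_nonneg (x := u)
  nlinarith [sq_nonneg ε]

/-- Substituting |u|² = 1 - q² makes the identities containing the square root rational in q. -/
theorem exists_sqrt_klein {u : Coord 2} (hu : 0 < 1 - ⟪u, u⟫) :
    ∃ q, q ≠ 0 ∧ √(1 - (1 - q ^ 2)) = q ∧ ⟪u, u⟫ = 1 - q ^ 2 := by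
  have h : ⟪u, u⟫ = 1 - √(1 - ⟪u, u⟫) ^ 2 := by
    rw [Real.sq_sqrt hu.le]
    ring
  exact ⟨_, (Real.sqrt_pos.2 hu).ne', by rw [← h], h⟩

theorem hasDirDeriv_kleinFactor {u : Coord 2} (hu : 1 - ⟪u, u⟫ ≠ 0) :
    HasDirDeriv kleinFactor u (fun X => 2 * ⟪u, X⟫ * kleinFactor u ^ 2) := by
  refine (((HasDirDeriv.const 1).sub (HasDirDeriv.id.inner HasDirDeriv.id)).inv
    hu).congr_deriv fun X => ?_
  rw [kleinFactor, real_inner_comm u X]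
  field_simp
  ring

theorem hasDirDeriv_sqrt_klein {u : Coord 2} (hu : 1 - ⟪u, u⟫ ≠ 0) :
    HasDirDeriv (fun u : Coord 2 => √(1 - ⟪u, u⟫)) u (fun X => -⟪u, X⟫ / √(1 - ⟪u, u⟫)) := by
  refine (((HasDirDeriv.const 1).sub (HasDirDeriv.id.inner HasDirDeriv.id)).sqrt
    hu).congr_deriv fun X => ?_
  rw [real_inner_comm u X]
  ring

/-- The Klein metric with a rotational Killing field. -/
def kleinData (hj : IsRightRotation j) : KillingData 2 (-1) where
  U := Metric.ball 0 (1 / √(1 + ε ^ 2))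
  isOpen_U := Metric.isOpen_ball
  h u := kleinFactor u • dot + kleinFactor u ^ 2 • squareForm u
  -- Geodesics of the Klein model are straight segments, so Γ(X, Y) is a combination of X and Y.
  Γ u := kleinFactor u • (leftForm u + rightForm u)
  J := kleinRot j
  W u := -ε • j u
  a u := -ε / √(1 - ⟪u, u⟫)
  h_symm u X Y := by
    simp only [add_apply, smul_apply, dot_apply, squareForm_apply, real_inner_comm X Y,
      smul_eq_mul]
    ring
  h_pos u hu X hX := by
    have h1 := inv_pos.2 (kleinFactor_den_pos ε hu)
    have h2 := real_inner_self_pos.2 hX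
    simp only [add_apply, smul_apply, dot_apply, smul_eq_mul, squareForm_apply, kleinFactor]
    have h3 := mul_pos h1 h2
    have h4 := mul_self_nonneg ⟪u, X⟫
    positivity
  Γ_symm u X Y := by
    simp only [add_apply, smul_apply, leftForm_apply, rightForm_apply]
    module
  W_lt u hu := by
    have h1 := kleinFactor_den_pos ε hu
    have h2 := inner_mul_lt ε hu
    -- Since ju is orthogonal to u, h(W, W) = ε²|u|²/(1 - |u|²), which is below 1 exactly when
    -- |u|²(1 + ε²) < 1.
    simp only [add_apply, smul_apply, dot_apply, squareForm_apply, smul_eq_mul, inner_smul_right,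
      real_inner_smul_left, hj.inner_map, hj.inner_self, kleinFactor]
    field_simp
    nlinarith
  J_skew u hu X Y := by
    have h3 : ⟪u, j X⟫ = -⟪X, j u⟫ := by rw [real_inner_comm, hj.skew]
    simp only [add_apply, smul_apply, dot_apply, squareForm_apply, smul_eq_mul,
      kleinRot_apply, map_add, map_smul,
      hj.inner_self, h3, hj.skew X Y, hj.skew u Y]
    ring
  J_sq u hu X := by
    obtain ⟨q, h0, hq, hr⟩ := exists_sqrt_klein (kleinFactor_den_pos ε hu)
    have w := hj.wedge u u X
    have h3 := hj.skew u X
    simp only [kleinRot_apply, map_add, map_smul, hj.sq,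
      hj.inner_self, kleinFactor, hq, h3, hr] at w ⊢
    linear_combination (norm := (match_scalars <;> field_simp <;> ring)) (1 : ℝ) • w
  wedge u hu X Y Z := by
    obtain ⟨q, h0, hq, hr⟩ := exists_sqrt_klein (kleinFactor_den_pos ε hu)
    have w1 := hj.wedge X Y Z
    have w2 := hj.wedge u Y Z
    have w3 := congrArg (⟪j u, ·⟫) (hj.wedge u Y Z)
    simp only [kleinRot_apply, map_add, map_smul, add_apply, smul_apply, dot_apply,
      squareForm_apply, smul_eq_mul, inner_smul_right, inner_sub_right,
      hj.inner_map,
      hj.inner_self, kleinFactor, hr, hq, hj.skew u Y] at w3 ⊢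
    linear_combination (norm := (match_scalars <;> field_simp <;> ring))
      (q ^ 2)⁻¹ • w1 + (((q ^ 2)⁻¹) ^ 2 * ⟪u, X⟫) • w2 -
        ((q ^ 2)⁻¹ * w3) • (j X + ((q ^ 2)⁻¹ * ⟪u, X⟫) • j u)
  deriv_h u hu := by
    have h1 := (kleinFactor_den_pos ε hu).ne'
    obtain ⟨D, hD, hD'⟩ := hasDirDeriv_squareForm u
    refine ⟨_, ((hasDirDeriv_kleinFactor h1).smul (HasDirDeriv.const dot)).add
      ((((hasDirDeriv_kleinFactor h1).mul (hasDirDeriv_kleinFactor h1)).congr_of_eventuallyEq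
        (.of_forall fun z => pow_two _)).smul hD), fun X Y Z => ?_⟩
    simp only [smul_apply, add_apply, dot_apply, smul_eq_mul, squareForm_apply, hD', smul_zero,
      zero_apply, leftForm_apply, rightForm_apply, inner_smul_right, real_inner_smul_left,
      inner_add_left, inner_add_right, real_inner_comm X Y, real_inner_comm u, kleinFactor]
    field_simp
    ring
  deriv_W u hu := by
    have h1 := kleinFactor_den_pos ε hu
    have h2 := (Real.sqrt_pos.2 h1).ne'
    refine ((HasDirDeriv.const (-ε)).smul (HasDirDeriv.clm j)).congr_deriv fun X => ?_
    simp only [kleinRot_apply, smul_apply, add_apply, leftForm_apply, rightForm_apply, map_smul,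
      map_add, hj.inner_self, kleinFactor]
    match_scalars <;> field_simp <;> ring
  deriv_J u hu := by
    have h1 := kleinFactor_den_pos ε hu
    obtain ⟨q, h0, hq, hr⟩ := exists_sqrt_klein h1
    have h2 : HasDirDeriv (fun u : Coord 2 => (kleinFactor u • dot u).smulRight u) u _ :=
      ((hasDirDeriv_kleinFactor h1.ne').smul (HasDirDeriv.clm dot)).smulRight HasDirDeriv.id
    have h3 := ((HasDirDeriv.const (ContinuousLinearMap.id ℝ (Coord 2))).add h2).comp_clm
      (ContinuousLinearMap.compL ℝ (Coord 2) (Coord 2) (Coord 2) j)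
    have h4 := (hasDirDeriv_sqrt_klein h1.ne').smul h3
    refine ⟨_, h4, fun X Y => ?_⟩
    have h5 := hj.skew u Y
    have w := congrArg j (hj.wedge X Y u)
    simp only [smul_apply, add_apply, ContinuousLinearMap.compL_apply, ContinuousLinearMap.comp_apply,
      ContinuousLinearMap.smulRight_apply, ContinuousLinearMap.id_apply, leftForm_apply,
      rightForm_apply, dot_apply, kleinRot_apply, map_add, map_smul, map_sub, map_zero, zero_apply,
      kleinFactor, hj.sq, hj.inner_self, smul_eq_mul, hr, hq,
      real_inner_comm u X, real_inner_comm u (j Y)] at w ⊢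
    linear_combination (norm := (match_scalars <;> field_simp <;> ring)) q⁻¹ • w
  deriv_a u hu := by
    have h1 := kleinFactor_den_pos ε hu
    have h2 := (Real.sqrt_pos.2 h1).ne'
    refine ((HasDirDeriv.const (-ε)).div (hasDirDeriv_sqrt_klein h1.ne') h2).congr_deriv fun X => ?_
    obtain ⟨q, h0, hq, hr⟩ := exists_sqrt_klein h1
    simp only [kleinRot_apply, smul_apply, add_apply, dot_apply, squareForm_apply, map_smul,
      map_add, hj.inner_map, hj.inner_self,
      kleinFactor, smul_eq_mul, real_inner_comm u X, hq, hr]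
    field_simp
    ring
  deriv_Γ u hu := by
    have h1 := (kleinFactor_den_pos ε hu).ne'
    have h2 : HasDirDeriv (fun u : Coord 2 => leftForm u + rightForm u) u
      (fun u => leftForm u + rightForm u) :=
      ⟨leftForm + rightForm, (leftForm + rightForm (E := Coord 2)).hasFDerivAt, fun _ => rfl⟩
    refine ⟨_, (hasDirDeriv_kleinFactor h1).smul h2, fun X Y Z => ?_⟩
    simp only [smul_apply, add_apply, leftForm_apply, rightForm_apply, dot_apply, squareForm_apply,
      inner_smul_right, inner_add_right, real_inner_comm X Y, real_inner_comm u, kleinFactor,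
      smul_eq_mul]
    match_scalars <;> field_simp <;> ring

end Klein

end Finsler
end

/-! ### Regularity of the Randers function. -/

noncomputable section
namespace Finsler

namespace NavigationData

variable {n : ℕ} {M : Type*} [TopologicalSpace M] [ChartedSpace (Coord n) M]
  [IsManifold (𝓡 n) 1 M] {K : ℝ} (D : NavigationData n M K)

theorem metric_self_pos {x : M} {y : TangentSpace (𝓡 n) x} (hy : y ≠ 0) :
    0 < D.metric x y y := by
  rw [D.metric_center]
  exact (D.loc x).h_pos _ (D.mem_U x) _ hy

theorem one_sub_metric_field_pos (x : M) :
    0 < 1 - D.eps ^ 2 * D.metric x (D.field x) (D.field x) := by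
  have h := (D.loc x).κ_pos (D.mem_U x)
  rwa [D.κ_chart x (D.mem_U x), OpenPartialHomeomorph.left_inv _ (mem_chart_source _ x)] at h

/-- The Randers function depends smoothly, for y ≠ 0, on the three scalars h(v, y), h(y, y), h(v,
v), so it suffices to know that these are smooth on the tangent bundle. -/
theorem isFinsler
    (hvy : ContMDiff (𝓡 n).tangent 𝓘(ℝ, ℝ) ∞
      fun p : TangentBundle (𝓡 n) M => D.metric p.1 (D.field p.1) p.2)
    (hyy : ContMDiff (𝓡 n).tangent 𝓘(ℝ, ℝ) ∞
      fun p : TangentBundle (𝓡 n) M => D.metric p.1 p.2 p.2)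
    (hvv : ContMDiff (𝓡 n).tangent 𝓘(ℝ, ℝ) ∞
      fun p : TangentBundle (𝓡 n) M => D.metric p.1 (D.field p.1) (D.field p.1)) :
    IsFinsler D.randers where
  continuous := by
    simp only [D.randers_eq, root]
    have h1 := hvy.continuous
    have h2 := hyy.continuous
    have h3 := hvv.continuous
    refine Continuous.div (by fun_prop) (by fun_prop) fun p => ?_
    exact (D.one_sub_metric_field_pos p.1).ne'
  smooth := by
    intro p hp
    have h1 : ContDiffAt ℝ ∞ (fun t : ℝ × ℝ × ℝ =>
        (√(D.eps ^ 2 * t.1 ^ 2 + t.2.1 * (1 - D.eps ^ 2 * t.2.2)) + D.eps * t.1) /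
          (1 - D.eps ^ 2 * t.2.2))
        (D.metric p.1 (D.field p.1) p.2, D.metric p.1 p.2 p.2,
          D.metric p.1 (D.field p.1) (D.field p.1)) := by
      have h2 := D.one_sub_metric_field_pos p.1
      have h3 := D.metric_self_pos (x := p.1) hp
      refine ContDiffAt.div (.add (.sqrt (by fun_prop) ?_) (by fun_prop)) (by fun_prop) h2.ne'
      positivity
    have h2 := h1.comp_contMDiffAt (x := p) (hvy p |>.prodMk_space (hyy p |>.prodMk_space (hvv p)))
    refine (h2.congr_of_eventuallyEq (.of_forall fun q => ?_)).contMDiffWithinAt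
    exact D.randers_eq q.1 q.2
  pos := D.randers_pos
  homogeneous x y t ht := D.randers_smul x ht y
  posDef := D.posDef

end NavigationData
end Finsler
end

noncomputable section
namespace Finsler

/-! ### The disk -/

/-- The rotation `(y₁, y₂) ↦ (-y₂, y₁)`. -/
def quarterTurn : Coord 2 →L[ℝ] Coord 2 :=
  LinearMap.toContinuousLinearMap
    { toFun := fun y => !₂[-y 1, y 0]
      map_add' := fun y z => by ext i; fin_cases i <;> simp; ring
      map_smul' := fun c y => by ext i; fin_cases i <;> simp }

theorem quarterTurn_apply (y : Coord 2) : quarterTurn y = !₂[-y 1, y 0] := rfl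

theorem isRightRotation_quarterTurn : IsRightRotation quarterTurn where
  skew X Y := by
    simp [quarterTurn_apply, PiLp.inner_apply, Fin.sum_univ_two]
  sq X := by ext i; fin_cases i <;> simp [quarterTurn_apply]

section Disk

variable {ε : ℝ}

theorem disk_chartAt_target (x : disk ε) : (chartAt (Coord 2) x).target = disk ε := by
  change ((OpenPartialHomeomorph.refl (Coord 2)).subtypeRestr ⟨x⟩).target = _
  simp [OpenPartialHomeomorph.subtypeRestr]

theorem disk_chartAt_symm (x : disk ε) {u : Coord 2} (hu : u ∈ disk ε) :
    (chartAt (Coord 2) x).symm u = ⟨u, hu⟩ :=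
  (chartAt (Coord 2) x).left_inv (x := ⟨u, hu⟩) (mem_chart_source _ (⟨u, hu⟩ : disk ε))

/-- All charts of the disk are the same inclusion, so every point is the centre of the chart in use.
-/
theorem disk_chartDeriv (x : disk ε) {u : Coord 2} (hu : u ∈ disk ε) (y : Coord 2) :
    toCoord _ (chartDeriv x u y) = y :=
  toCoord_chartDeriv_center (⟨u, hu⟩ : disk ε) y

theorem mfderiv_disk_val (x : disk ε) (y : TangentSpace (𝓡 2) x) :
    mfderiv (𝓡 2) 𝓘(ℝ, Coord 2) (Subtype.val : disk ε → Coord 2) x y = toCoord x y := by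
  change mfderiv (𝓡 2) (𝓡 2) (chartAt (Coord 2) x) x y = _
  rw [mfderiv_chartAt_eq_tangentCoordChange (mem_chart_source _ x)]
  exact tangentCoordChange_self (I := 𝓡 2) (mem_extChartAt_source x)

theorem contMDiff_disk_toCoord : ContMDiff (𝓡 2).tangent 𝓘(ℝ, Coord 2) ∞
    (fun p : TangentBundle (𝓡 2) (disk ε) => toCoord p.1 p.2) := by
  have h1 : ContMDiff (𝓡 2) 𝓘(ℝ, Coord 2) ∞ (Subtype.val : disk ε → Coord 2) :=
    contMDiff_subtype_val
  have h2 := (contMDiff_snd_tangentBundle_modelSpace (Coord 2) 𝓘(ℝ, Coord 2)).comp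
    (h1.contMDiff_tangentMap (m := ∞) (by simp))
  exact h2.congr fun p => (mfderiv_disk_val p.1 p.2).symm

theorem contMDiff_disk_proj : ContMDiff (𝓡 2).tangent 𝓘(ℝ, Coord 2) ∞
    (fun p : TangentBundle (𝓡 2) (disk ε) => (p.1.1 : Coord 2)) :=
  contMDiff_subtype_val.comp (Bundle.contMDiff_proj (TangentSpace (𝓡 2) : disk ε → Type))

theorem one_sub_norm_sq_pos (x : disk ε) : 0 < 1 - ‖(x.1 : Coord 2)‖ ^ 2 := by
  rw [← real_inner_self_eq_norm_sq]
  exact kleinFactor_den_pos ε x.2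

theorem kleinForm_apply {u : Coord 2} (hu : u ∈ disk ε) (y z : Coord 2) :
    kleinFactor u * ⟪y, z⟫ + kleinFactor u ^ 2 * (⟪u, y⟫ * ⟪u, z⟫) = kleinMetric u y z := by
  have := (one_sub_norm_sq_pos ⟨u, hu⟩).ne'
  simp only at this
  rw [kleinFactor, kleinMetric, real_inner_self_eq_norm_sq]
  field_simp

theorem contDiffAt_kleinMetric {E : Type*} [NormedAddCommGroup E] [NormedSpace ℝ E]
    {f g k : E → Coord 2} {p : E} (hf : ContDiffAt ℝ ∞ f p) (hg : ContDiffAt ℝ ∞ g p)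
    (hk : ContDiffAt ℝ ∞ k p) (hp : f p ∈ disk ε) :
    ContDiffAt ℝ ∞ (fun q => kleinMetric (f q) (g q) (k q)) p := by
  have := (one_sub_norm_sq_pos ⟨f p, hp⟩).ne'
  have h2 := hf.norm_sq ℝ
  have h3 := hg.inner ℝ hk
  have h4 := hf.inner ℝ hg
  have h5 := hf.inner ℝ hk
  exact ContDiffAt.div ((h3.mul (contDiffAt_const.sub h2)).add (h4.mul h5))
    ((contDiffAt_const.sub h2).pow 2) (pow_ne_zero 2 this)

theorem contDiffAt_kleinRot {p : Coord 2 × Coord 2 × Coord 2} (hp : p.1 ∈ disk ε) :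
    ContDiffAt ℝ ∞ (fun q : Coord 2 × Coord 2 × Coord 2 => kleinRot quarterTurn q.1 q.2.1) p := by
  have := (kleinFactor_den_pos ε hp).ne'
  have h1 : ContDiffAt ℝ ∞ (fun q : Coord 2 × Coord 2 × Coord 2 => 1 - ⟪q.1, q.1⟫) p :=
    contDiffAt_const.sub (contDiffAt_fst.inner ℝ contDiffAt_fst)
  have h2 : ContDiffAt ℝ ∞ (fun q : Coord 2 × Coord 2 × Coord 2 => ⟪q.1, q.2.1⟫) p :=
    contDiffAt_fst.inner ℝ (by fun_prop)
  exact (h1.sqrt this).smul (quarterTurn.contDiff.contDiffAt.comp p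
    ((contDiffAt_fst.comp p contDiffAt_snd).add (((h1.inv this).mul h2).smul contDiffAt_fst)))

/-- The navigation data of the disk. -/
def diskData (ε : ℝ) : NavigationData 2 (disk ε) (-1) where
  metric := diskMetric ε
  field := diskField ε
  rot x y := ofCoord x (kleinRot quarterTurn x.1 (toCoord x y))
  eps := ε
  loc _ := kleinData quarterTurn ε isRightRotation_quarterTurn
  metric_smul_left x c y z := by
    have h : toCoord x (c • y) = c • toCoord x y := rfl
    simp only [diskMetric, kleinMetric, h, real_inner_smul_left, real_inner_smul_right]
    ring
  metric_symm x y z := by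
    rw [diskMetric, diskMetric, kleinMetric, kleinMetric, real_inner_comm, mul_comm ⟪_, toCoord x z⟫]
  rot_smul x c y := map_smul (kleinRot quarterTurn x.1) c y
  mem_U x := x.2
  U_subset x := (disk_chartAt_target x).ge
  metric_chart x u hu y z := by
    refine (kleinForm_apply hu y z).trans ?_
    rw [diskMetric, disk_chartDeriv x hu, disk_chartDeriv x hu, disk_chartAt_symm x hu]
  field_chart x u hu := by
    have h : toCoord _ (diskField ε ((chartAt (Coord 2) x).symm u)) = quarterTurn u := by
      rw [disk_chartAt_symm x hu]
      rfl
    exact (disk_chartDeriv x hu _).trans (congrArg (-ε • ·) h.symm)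
  rot_chart x u hu y := by
    refine (disk_chartDeriv x hu _).trans ?_
    rw [disk_chartDeriv x hu, disk_chartAt_symm x hu]
    rfl
  contMDiff_area X Y hX hY := by
    intro x
    have h1 : ContDiffAt ℝ ∞ (fun q : Coord 2 × Coord 2 × Coord 2 =>
        kleinMetric q.1 (kleinRot quarterTurn q.1 q.2.1) q.2.2)
        ((x.1, toCoord x (X x), toCoord x (Y x)) : Coord 2 × Coord 2 × Coord 2) :=
      contDiffAt_kleinMetric contDiffAt_fst (contDiffAt_kleinRot x.2) (by fun_prop) x.2
    exact h1.comp_contMDiffAt (x := x) (contMDiff_subtype_val x |>.prodMk_space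
      ((contMDiff_disk_toCoord.comp hX x).prodMk_space (contMDiff_disk_toCoord.comp hY x)))

theorem isFinsler_diskData (ε : ℝ) : IsFinsler (diskData ε).randers := by
  refine (diskData ε).isFinsler (fun p => ?_) (fun p => ?_) (fun p => ?_)
  · have h1 : ContDiffAt ℝ ∞ (fun q : Coord 2 × Coord 2 => kleinMetric q.1 (quarterTurn q.1) q.2)
        ((p.1.1, toCoord p.1 p.2) : Coord 2 × Coord 2) :=
      contDiffAt_kleinMetric contDiffAt_fst
        (quarterTurn.contDiff.contDiffAt.comp _ contDiffAt_fst) contDiffAt_snd p.1.2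
    exact h1.comp_contMDiffAt (x := p)
      ((contMDiff_disk_proj p).prodMk_space (contMDiff_disk_toCoord p))
  · have h1 : ContDiffAt ℝ ∞ (fun q : Coord 2 × Coord 2 => kleinMetric q.1 q.2 q.2)
        ((p.1.1, toCoord p.1 p.2) : Coord 2 × Coord 2) :=
      contDiffAt_kleinMetric contDiffAt_fst contDiffAt_snd contDiffAt_snd p.1.2
    exact h1.comp_contMDiffAt (x := p)
      ((contMDiff_disk_proj p).prodMk_space (contMDiff_disk_toCoord p))
  · have h1 : ContDiffAt ℝ ∞ (fun q : Coord 2 => kleinMetric q (quarterTurn q) (quarterTurn q))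
        (p.1.1 : Coord 2) :=
      contDiffAt_kleinMetric contDiffAt_id quarterTurn.contDiff.contDiffAt
        quarterTurn.contDiff.contDiffAt p.1.2
    exact h1.comp_contMDiffAt (x := p) (contMDiff_disk_proj p)

end Disk

end Finsler
end

noncomputable section
namespace Finsler

/-! ### The vector product -/

/-- The vector product of `ℝ³`. -/
def cross : Coord (2 + 1) →L[ℝ] Coord (2 + 1) →L[ℝ] Coord (2 + 1) :=
  LinearMap.toContinuousBilinearMap <| LinearMap.mk₂ ℝ
    (fun a b => !₂[a 1 * b 2 - a 2 * b 1, a 2 * b 0 - a 0 * b 2, a 0 * b 1 - a 1 * b 0])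
    (fun a b c => by ext i; fin_cases i <;> simp <;> ring)
    (fun t a b => by ext i; fin_cases i <;> simp <;> ring)
    (fun a b c => by ext i; fin_cases i <;> simp <;> ring)
    (fun t a b => by ext i; fin_cases i <;> simp <;> ring)

theorem cross_apply (a b : Coord (2 + 1)) : cross a b =
    !₂[a 1 * b 2 - a 2 * b 1, a 2 * b 0 - a 0 * b 2, a 0 * b 1 - a 1 * b 0] := rfl

theorem cross_self (a : Coord (2 + 1)) : cross a a = 0 := by
  ext i
  fin_cases i <;> simp [cross_apply] <;> ring

theorem cross_comm (a b : Coord (2 + 1)) : cross a b = -cross b a := by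
  ext i
  fin_cases i <;> simp [cross_apply] <;> ring

theorem inner_cross_self_left (a b : Coord (2 + 1)) : ⟪a, cross a b⟫ = 0 := by
  simp [cross_apply, PiLp.inner_apply, Fin.sum_univ_three]
  ring

theorem inner_cross (a b c : Coord (2 + 1)) : ⟪cross a b, c⟫ = -⟪b, cross a c⟫ := by
  simp [cross_apply, PiLp.inner_apply, Fin.sum_univ_three]
  ring

theorem cross_cross (a b c : Coord (2 + 1)) :
    cross a (cross b c) = ⟪a, c⟫ • b - ⟪a, b⟫ • c := by
  ext i
  fin_cases i <;> simp [cross_apply, PiLp.inner_apply, Fin.sum_univ_three] <;> ring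

/-! ### Stereographic coordinates -/

/-- `P` maps `ℝ²` isometrically onto the plane orthogonal to the unit vector `x`. -/
structure IsFrame (x : Coord (2 + 1)) (P : Coord 2 →L[ℝ] Coord (2 + 1)) : Prop where
  inner_self : ⟪x, x⟫ = 1
  inner_zero : ∀ y, ⟪x, P y⟫ = 0
  inner_map : ∀ y z, ⟪P y, P z⟫ = ⟪y, z⟫
  exists_eq : ∀ w, ⟪x, w⟫ = 0 → ∃ y, P y = w

section Frame

variable (x : Coord (2 + 1)) (P : Coord 2 →L[ℝ] Coord (2 + 1))

/-- The rotation by a right angle induced by the vector product with `x`. -/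
def frameRot : Coord 2 →L[ℝ] Coord 2 := ContinuousLinearMap.adjoint P ∘L cross x ∘L P

/-- The inverse of the stereographic projection. -/
def stereoPoint (u : Coord 2) : Coord (2 + 1) :=
  stereoFactor u • ((4 : ℝ) • P u - (⟪u, u⟫ - 4) • x)

/-- The derivative of `stereoPoint`. -/
def stereoDeriv (u y : Coord 2) : Coord (2 + 1) :=
  (4 * stereoFactor u) • P y - (2 * stereoFactor u * ⟪u, y⟫) • x -
    (2 * stereoFactor u * ⟪u, y⟫) • stereoPoint x P u

theorem hasDirDeriv_stereoPoint (u : Coord 2) :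
    HasDirDeriv (stereoPoint x P) u (stereoDeriv x P u) := by
  refine ((hasDirDeriv_stereoFactor u).smul (((HasDirDeriv.const 4).smul (HasDirDeriv.clm P)).sub
    (((HasDirDeriv.id.inner HasDirDeriv.id).sub (HasDirDeriv.const 4)).smul
      (HasDirDeriv.const x)))).congr_deriv fun y => ?_
  rw [stereoDeriv, stereoPoint, real_inner_comm u y]
  module

variable {x P} (hP : IsFrame x P)
include hP

/-- The vector product with x stays in the plane orthogonal to x, where the adjoint of P inverts P.
-/
theorem IsFrame.frameRot_apply (y : Coord 2) : P (frameRot x P y) = cross x (P y) := by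
  obtain ⟨z, hz⟩ := hP.exists_eq _ (inner_cross_self_left x (P y))
  have h : ContinuousLinearMap.adjoint P (P z) = z := ext_inner_left ℝ fun w => by
    rw [ContinuousLinearMap.adjoint_inner_right, hP.inner_map]
  rw [frameRot, ContinuousLinearMap.comp_apply, ContinuousLinearMap.comp_apply, ← hz, h]

theorem IsFrame.injective {y z : Coord 2} (h : P y = P z) : y = z := by
  rw [← sub_eq_zero, ← inner_self_eq_zero (𝕜 := ℝ), ← hP.inner_map, map_sub, h, sub_self,
    inner_zero_left]

theorem IsFrame.isRightRotation : IsRightRotation (frameRot x P) where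
  skew y z := by
    rw [← hP.inner_map, ← hP.inner_map, hP.frameRot_apply, hP.frameRot_apply, inner_cross]
  sq y := by
    apply hP.injective
    rw [hP.frameRot_apply, hP.frameRot_apply, cross_cross, hP.inner_zero, hP.inner_self, map_neg]
    module

theorem IsFrame.cross_left (y : Coord 2) : cross (P y) x = -P (frameRot x P y) := by
  rw [cross_comm, hP.frameRot_apply]

theorem IsFrame.cross_map (y z : Coord 2) :
    cross (P y) (P z) = ⟪frameRot x P y, z⟫ • x := by
  have h1 : P z = - cross x (P (frameRot x P z)) := by
    rw [← hP.frameRot_apply, hP.isRightRotation.sq, map_neg, neg_neg]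
  rw [h1, map_neg, cross_cross, real_inner_comm x (P y), hP.inner_zero, hP.inner_map,
    hP.isRightRotation.skew]
  module

theorem IsFrame.inner_stereoPoint (u : Coord 2) :
    ⟪stereoPoint x P u, stereoPoint x P u⟫ = 1 := by
  have h1 := (stereoFactor_den_pos u).ne'
  simp only [stereoPoint, real_inner_smul_left, inner_smul_right, inner_sub_left, inner_sub_right,
    hP.inner_self, hP.inner_map, hP.inner_zero, real_inner_comm x (P _), stereoFactor]
  field_simp
  ring

theorem IsFrame.inner_stereoDeriv (u y z : Coord 2) :
    ⟪stereoDeriv x P u y, stereoDeriv x P u z⟫ = 16 * stereoFactor u ^ 2 * ⟪y, z⟫ := by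
  have h1 := (stereoFactor_den_pos u).ne'
  simp only [stereoDeriv, stereoPoint, real_inner_smul_left, inner_smul_right, inner_sub_left,
    inner_sub_right, hP.inner_self, hP.inner_map, hP.inner_zero, real_inner_comm x (P _),
    stereoFactor, real_inner_comm u y]
  field_simp
  ring

/-- Stereographic projection is conformal, so the rotation of each tangent plane appears as the same
constant rotation in the chart. -/
theorem IsFrame.cross_stereoDeriv (u y : Coord 2) :
    cross (stereoPoint x P u) (stereoDeriv x P u y) = stereoDeriv x P u (frameRot x P y) := by
  have h1 := (stereoFactor_den_pos u).ne'
  have h2 := hP.isRightRotation.skew u y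
  have h3 : ⟪frameRot x P u, u⟫ = 0 := by rw [real_inner_comm, hP.isRightRotation.inner_self]
  have w := congrArg P (hP.isRightRotation.wedge u u (frameRot x P y))
  simp only [stereoDeriv, stereoPoint, map_smul, map_sub, smul_apply, sub_apply, cross_self,
    hP.cross_left, hP.cross_map, ← hP.frameRot_apply, stereoFactor, h2, h3,
    hP.isRightRotation.inner_map] at w ⊢
  linear_combination (norm := (match_scalars <;> field_simp <;> ring))
    (-8 * (4 + ⟪u, u⟫)⁻¹ ^ 2) • w

/-- `stereoField` is the rotation field of S² about the axis c x + P(jβ), read in the chart; c and β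
encode the normal and tangential parts of the axis. -/
theorem IsFrame.stereoDeriv_stereoField (c : ℝ) (β u : Coord 2) :
    stereoDeriv x P u (stereoField (frameRot x P) c β u) =
      cross (c • x + P (frameRot x P β)) (stereoPoint x P u) := by
  have h1 := (stereoFactor_den_pos u).ne'
  simp only [stereoDeriv, stereoPoint, stereoField, map_smul, map_sub, map_add, smul_apply,
    add_apply, cross_self, hP.cross_left, hP.cross_map, ← hP.frameRot_apply,
    stereoFactor, hP.isRightRotation.sq, inner_add_right, inner_smul_right,
    hP.isRightRotation.inner_self, inner_neg_left, map_neg,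
    real_inner_comm u β]
  match_scalars <;> field_simp <;> ring

theorem IsFrame.inner_stereoField (c : ℝ) (β u : Coord 2) :
    16 * stereoFactor u ^ 2 *
        ⟪stereoField (frameRot x P) c β u, stereoField (frameRot x P) c β u⟫ =
      ⟪cross (c • x + P (frameRot x P β)) (stereoPoint x P u),
        cross (c • x + P (frameRot x P β)) (stereoPoint x P u)⟫ := by
  rw [← hP.inner_stereoDeriv, hP.stereoDeriv_stereoField]

end Frame

end Finsler
end

noncomputable section
namespace Finsler

/-! ### The sphere -/

theorem fact_finrank_three : Fact (Module.finrank ℝ (Coord (2 + 1)) = 2 + 1) :=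
  ⟨finrank_euclideanSpace_fin⟩

attribute [local instance] fact_finrank_three

theorem Sphere2.inner_self (x : Sphere2) : ⟪x.1, x.1⟫ = 1 := by
  rw [real_inner_self_eq_norm_sq, norm_eq_of_mem_sphere, one_pow]

/-- The isometry of `ℝ²` onto the tangent plane used by the chart around `x`. -/
def sphereFrame (x : Sphere2) : Coord 2 →L[ℝ] Coord (2 + 1) :=
  (ℝ ∙ ((-x : Sphere2) : Coord (2 + 1)))ᗮ.subtypeL ∘L
    (OrthonormalBasis.fromOrthogonalSpanSingleton 2
      (ne_zero_of_mem_unit_sphere (-x))).repr.symm.toContinuousLinearEquiv.toContinuousLinearMap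

theorem isFrame_sphereFrame (x : Sphere2) : IsFrame x.1 (sphereFrame x) where
  inner_self := x.inner_self
  inner_zero y := by
    have h : sphereFrame x y ∈ (ℝ ∙ ((-x : Sphere2) : Coord (2 + 1)))ᗮ := Subtype.property _
    rw [Submodule.mem_orthogonal_singleton_iff_inner_right] at h
    simpa using h
  inner_map y z := LinearIsometryEquiv.inner_map_map (OrthonormalBasis.fromOrthogonalSpanSingleton 2
      (ne_zero_of_mem_unit_sphere (-x))).repr.symm y z
  exists_eq w hw := by
    have h : w ∈ (ℝ ∙ ((-x : Sphere2) : Coord (2 + 1)))ᗮ := by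
      rw [Submodule.mem_orthogonal_singleton_iff_inner_right]
      simpa using hw
    obtain ⟨y, hy⟩ := (OrthonormalBasis.fromOrthogonalSpanSingleton 2
      (ne_zero_of_mem_unit_sphere (-x))).repr.symm.surjective ⟨w, h⟩
    exact ⟨y, congrArg Subtype.val hy⟩

/-- The chart around x projects from the antipode -x, hence x has coordinate 0. -/
theorem sphere_chartAt_symm (x : Sphere2) (u : Coord 2) :
    ((chartAt (Coord 2) x).symm u).1 = stereoPoint x.1 (sphereFrame x) u := by
  refine (stereographic'_symm_apply (-x) u).trans ?_
  have h : ‖sphereFrame x u‖ ^ 2 = ⟪u, u⟫ := by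
    rw [← real_inner_self_eq_norm_sq, (isFrame_sphereFrame x).inner_map]
  change (‖sphereFrame x u‖ ^ 2 + 4)⁻¹ • (4 : ℝ) • sphereFrame x u +
    (‖sphereFrame x u‖ ^ 2 + 4)⁻¹ • (‖sphereFrame x u‖ ^ 2 - 4) • (-x.1) = _
  rw [h, stereoPoint, stereoFactor, add_comm ⟪u, u⟫]
  module

theorem sphere_chartAt_target (x : Sphere2) : (chartAt (Coord 2) x).target = Set.univ :=
  stereographic'_target (-x)

theorem sphereIncl_chartDeriv (x : Sphere2) (u y : Coord 2) :
    sphereIncl _ (chartDeriv x u y) = stereoDeriv x.1 (sphereFrame x) u y := by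
  have h1 : MDifferentiableAt (𝓡 2) (𝓡 2) (chartAt (Coord 2) x).symm u :=
    (mdifferentiable_chart (I := 𝓡 2) x).symm.mdifferentiableAt (by
      rw [OpenPartialHomeomorph.symm_source, sphere_chartAt_target]
      trivial)
  have h2 : MDifferentiableAt (𝓡 2) 𝓘(ℝ, Coord (2 + 1)) ((↑) : Sphere2 → Coord (2 + 1))
      ((chartAt (Coord 2) x).symm u) :=
    (contMDiff_coe_sphere _).mdifferentiableAt one_ne_zero
  have h3 := mfderiv_comp_apply u h2 h1 y
  have h4 : ((↑) : Sphere2 → Coord (2 + 1)) ∘ (chartAt (Coord 2) x).symm =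
      stereoPoint x.1 (sphereFrame x) := funext (sphere_chartAt_symm x)
  rw [h4, mfderiv_eq_fderiv] at h3
  exact h3.symm.trans ((hasDirDeriv_stereoPoint x.1 (sphereFrame x) u).fderiv_apply y)

theorem sphereIncl_injective (x : Sphere2) {y z : TangentSpace (𝓡 2) x}
    (h : sphereIncl x y = sphereIncl x z) : y = z :=
  injective_mvfderiv_subtypeVal_sphere x h

theorem exists_sphereIncl_eq (x : Sphere2) {w : Coord (2 + 1)} (hw : ⟪x.1, w⟫ = 0) :
    ∃ y, sphereIncl x y = w := by
  have h : w ∈ (mvfderiv (𝓡 2) ((↑) : Sphere2 → Coord (2 + 1)) x).range := by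
    rwa [range_mvfderiv_subtypeVal, Submodule.mem_orthogonal_singleton_iff_inner_right]
  exact h

/-- The rotation of the tangent planes by a right angle. -/
def sphereRot (x : Sphere2) (y : TangentSpace (𝓡 2) x) : TangentSpace (𝓡 2) x :=
  (exists_sphereIncl_eq x (inner_cross_self_left x.1 (sphereIncl x y))).choose

theorem sphereIncl_sphereRot (x : Sphere2) (y : TangentSpace (𝓡 2) x) :
    sphereIncl x (sphereRot x y) = cross x.1 (sphereIncl x y) :=
  (exists_sphereIncl_eq x (inner_cross_self_left x.1 (sphereIncl x y))).choose_spec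

/-- The axis of rotation. -/
def axis : Coord (2 + 1) := !₂[0, 0, 1]

theorem sphereIncl_sphereField_eq_cross (x : Sphere2) :
    sphereIncl x (sphereField x) = cross axis x.1 := by
  rw [sphereIncl_sphereField, cross_apply]
  ext i
  fin_cases i <;> simp [axis]

theorem inner_cross_axis_le (w : Coord (2 + 1)) (hw : ⟪w, w⟫ = 1) :
    ⟪cross axis w, cross axis w⟫ ≤ 1 := by
  simp only [cross_apply, PiLp.inner_apply, Fin.sum_univ_three, axis] at hw ⊢
  simp [Fin.sum_univ_three] at hw ⊢
  nlinarith [sq_nonneg (w 2)]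

theorem exists_axis_decomposition (ε : ℝ) (x : Sphere2) : ∃ (c : ℝ) (β : Coord 2),
    c • x.1 + sphereFrame x (frameRot x.1 (sphereFrame x) β) = -ε • axis := by
  have hP := isFrame_sphereFrame x
  obtain ⟨α, hα⟩ := hP.exists_eq (axis - ⟪x.1, axis⟫ • x.1) (by
    rw [inner_sub_right, inner_smul_right, x.inner_self, mul_one, sub_self])
  -- Here α is the tangential part of the axis; one further rotation turns the second witness into
  -- -εα.
  refine ⟨-ε * ⟪x.1, axis⟫, ε • frameRot x.1 (sphereFrame x) α, ?_⟩
  rw [map_smul, hP.isRightRotation.sq, map_smul, map_neg, hα]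
  module

theorem contMDiff_sphereIncl : ContMDiff (𝓡 2).tangent 𝓘(ℝ, Coord (2 + 1)) ∞
    (fun p : TangentBundle (𝓡 2) Sphere2 => sphereIncl p.1 p.2) := by
  have h1 : ContMDiff (𝓡 2) 𝓘(ℝ, Coord (2 + 1)) ∞ ((↑) : Sphere2 → Coord (2 + 1)) :=
    contMDiff_coe_sphere
  exact (contMDiff_snd_tangentBundle_modelSpace (Coord (2 + 1)) 𝓘(ℝ, Coord (2 + 1))).comp
    (h1.contMDiff_tangentMap (m := ∞) (by simp))

theorem contMDiff_sphere_proj : ContMDiff (𝓡 2).tangent 𝓘(ℝ, Coord (2 + 1)) ∞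
    (fun p : TangentBundle (𝓡 2) Sphere2 => (p.1.1 : Coord (2 + 1))) :=
  contMDiff_coe_sphere.comp (Bundle.contMDiff_proj (TangentSpace (𝓡 2) : Sphere2 → Type))

theorem chartDeriv_stereoField (x : Sphere2) (u : Coord 2) {ε c : ℝ} {β : Coord 2}
    (h : c • x.1 + sphereFrame x (frameRot x.1 (sphereFrame x) β) = -ε • axis) :
    chartDeriv x u (stereoField (frameRot x.1 (sphereFrame x)) c β u) =
      -ε • sphereField ((chartAt (Coord 2) x).symm u) := by
  apply sphereIncl_injective
  have h1 := (isFrame_sphereFrame x).stereoDeriv_stereoField c β u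
  rw [h, map_smul, smul_apply, ← sphere_chartAt_symm, ← sphereIncl_sphereField_eq_cross] at h1
  exact (sphereIncl_chartDeriv x u _).trans (h1.trans ((sphereIncl _).map_smul _ _).symm)

theorem chartDeriv_frameRot (x : Sphere2) (u y : Coord 2) :
    chartDeriv x u (frameRot x.1 (sphereFrame x) y) =
      sphereRot ((chartAt (Coord 2) x).symm u) (chartDeriv x u y) := by
  apply sphereIncl_injective
  have h1 := (isFrame_sphereFrame x).cross_stereoDeriv u y
  rw [← sphere_chartAt_symm, ← sphereIncl_chartDeriv, ← sphereIncl_chartDeriv] at h1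
  exact h1.symm.trans (sphereIncl_sphereRot _ _).symm

/-- The navigation data of the sphere. -/
def sphereData (ε : ℝ) (hε : |ε| < 1) : NavigationData 2 Sphere2 1 where
  metric := sphereMetric
  field := sphereField
  rot := sphereRot
  eps := ε
  loc x := stereoData (frameRot x.1 (sphereFrame x)) (exists_axis_decomposition ε x).choose
    (exists_axis_decomposition ε x).choose_spec.choose (isFrame_sphereFrame x).isRightRotation
    fun u => by
      rw [(isFrame_sphereFrame x).inner_stereoField,
        (exists_axis_decomposition ε x).choose_spec.choose_spec, map_smul, smul_apply,
        real_inner_smul_left, inner_smul_right]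
      -- The squared length of W is ε² times that of the unit-speed rotation field, which is at most
      -- 1 on the sphere.
      have h1 := inner_cross_axis_le _ ((isFrame_sphereFrame x).inner_stereoPoint u)
      have h2 := (sq_lt_one_iff_abs_lt_one ε).2 hε
      nlinarith [sq_nonneg ε]
  metric_smul_left x c y z := by rw [sphereMetric, map_smul, real_inner_smul_left, sphereMetric]
  metric_symm x y z := real_inner_comm _ _
  rot_smul x c y := sphereIncl_injective x (by
    rw [sphereIncl_sphereRot, map_smul, map_smul, map_smul, sphereIncl_sphereRot])
  mem_U x := trivial
  U_subset x := (sphere_chartAt_target x).ge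
  metric_chart x u hu y z := by
    rw [sphereMetric, sphereIncl_chartDeriv, sphereIncl_chartDeriv,
      (isFrame_sphereFrame x).inner_stereoDeriv]
    rfl
  field_chart x u hu := chartDeriv_stereoField x u
    (exists_axis_decomposition ε x).choose_spec.choose_spec
  rot_chart x u hu y := chartDeriv_frameRot x u y
  contMDiff_area X Y hX hY := by
    have h1 : ContDiff ℝ ∞ (fun q : Coord (2 + 1) × Coord (2 + 1) × Coord (2 + 1) =>
        ⟪cross q.1 q.2.1, q.2.2⟫) :=
      ((cross.contDiff.comp contDiff_fst).clm_apply (contDiff_fst.comp contDiff_snd)).inner ℝ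
        (contDiff_snd.comp contDiff_snd)
    have h2 : ContMDiff (𝓡 2) 𝓘(ℝ, Coord (2 + 1)) ∞ ((↑) : Sphere2 → Coord (2 + 1)) :=
      contMDiff_coe_sphere
    refine (h1.comp_contMDiff (h2.prodMk_space
      ((contMDiff_sphereIncl.comp hX).prodMk_space (contMDiff_sphereIncl.comp hY)))).congr
      fun x => ?_
    rw [sphereMetric, sphereIncl_sphereRot]
    rfl

theorem isFinsler_sphereData (ε : ℝ) (hε : |ε| < 1) : IsFinsler (sphereData ε hε).randers := by
  have h1 : ContDiff ℝ ∞ (fun q : Coord (2 + 1) × Coord (2 + 1) => ⟪cross axis q.1, q.2⟫) :=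
    ((cross axis).contDiff.comp contDiff_fst).inner ℝ contDiff_snd
  have h2 : ContDiff ℝ ∞ (fun q : Coord (2 + 1) => ⟪cross axis q, cross axis q⟫) :=
    (cross axis).contDiff.inner ℝ (cross axis).contDiff
  have h3 : ContDiff ℝ ∞ (fun q : Coord (2 + 1) => ⟪q, q⟫) := contDiff_id.inner ℝ contDiff_id
  refine (sphereData ε hε).isFinsler ?_ ?_ ?_
  · refine (h1.comp_contMDiff (contMDiff_sphere_proj.prodMk_space contMDiff_sphereIncl)).congr
      fun p => ?_
    exact congrArg (⟪·, sphereIncl p.1 p.2⟫) (sphereIncl_sphereField_eq_cross p.1)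
  · exact h3.comp_contMDiff contMDiff_sphereIncl
  · refine (h2.comp_contMDiff contMDiff_sphere_proj).congr fun p => ?_
    exact congrArg (fun w => ⟪w, w⟫) (sphereIncl_sphereField_eq_cross p.1)

end Finsler
end
theorem mainTheorem6 :
    (∀ ε : ℝ, |ε| < 1 →
      Finsler.IsFinsler (Finsler.sphereRanders ε) ∧
      Finsler.HasConstantFlagCurvature (Finsler.sphereRanders ε) 1 ∧
      ∀ x : Finsler.Sphere2,
        Finsler.holonomyAlgebraAt (Finsler.sphereRanders ε) x =
          Finsler.curvatureAlgebraAt (Finsler.sphereRanders ε) x) ∧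
    (∀ ε : ℝ,
      Finsler.IsFinsler (Finsler.diskRanders ε) ∧
      Finsler.HasConstantFlagCurvature (Finsler.diskRanders ε) (-1) ∧
      ∀ x : Finsler.disk ε,
        Finsler.holonomyAlgebraAt (Finsler.diskRanders ε) x =
          Finsler.curvatureAlgebraAt (Finsler.diskRanders ε) x) := by
  -- `sphereRanders` and `diskRanders` are by definition the `randers` functions of the two
  -- navigation data, so the general results apply with K = 1 and K = -1.
  refine ⟨fun ε hε => ⟨Finsler.isFinsler_sphereData ε hε,
    (Finsler.sphereData ε hε).hasConstantFlagCurvature, fun x => ?_⟩, fun ε =>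
    ⟨Finsler.isFinsler_diskData ε, (Finsler.diskData ε).hasConstantFlagCurvature, fun x => ?_⟩⟩
  · have : IsManifold (𝓡 2) ∞ Finsler.Sphere2 := .of_le (n := ω) le_top
    exact (Finsler.sphereData ε hε).holonomyAlgebraAt_eq one_ne_zero x
  · exact (Finsler.diskData ε).holonomyAlgebraAt_eq (by norm_num) x
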